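/- Let $\mathbb K$ be an algebraically closed field of characteristic zero and $n\ge 0$. Put $e_{m}=\frac1{m!}\sum_{\omega\in S_m}\omega\in\mathbb K S_m$, and for a composition $\mathbf c=(c_1,\dots,c_r)$ of $n$ let $e_{\mathbf c}=e_{c_1}\otimes\cdots\otimes e_{c_r}\in\mathbb K S_{c_1}\otimes\cdots\otimes\mathbb K S_{c_r}\subset\mathbb K S_n$; let $\lambda_{\mathbf c}$ be the partition of $n$ obtained by sorting $\mathbf c$. Let $S^\lambda$ be the Specht module of $\mathbb K S_n$ attached to $\lambda\vdash n$, and let $>$ be the lexicographic order on partitions of $n$ (parts written in weakly decreasing order). (1) For every $\lambda\vdash n$ and every composition $\mathbf c$ of $n$, $$\dim_{\mathbb K}(e_{\mathbf c}\cdot S^\lambda)=\begin{cases}1&\text{if }\lambda_{\mathbf c}=\lambda,\\ 0&\text{if }\lambda_{\mathbf c}>\lambda.\end{cases}$$ (2) Let $(I,A,\cdot)$ be a Borcherds-Cartan datum with symmetrizing integers $r_j>0$ $(j\in I)$, and let $i\in I$ with $a_{ii}=0$. Let $R(ni)$ be the associated Khovanov-Lauda-Rouquier algebra: the graded $\mathbb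 K$-algebra with generators $x_1,\dots,x_n$ of degree $2r_i$ and $\tau_1,\dots,\tau_{n-1}$ of degree $0$, and relations $x_ax_b=x_bx_a$, $\tau_k^2=1$, $\tau_kx_k=x_{k+1}\tau_k$, $\tau_kx_{k+1}=x_k\tau_k$, $\tau_kx_a=x_a\tau_k$ for $a\ne k,k+1$, $\tau_k\tau_l=\tau_l\tau_k$ for $|k-l|>1$, and $\tau_k\tau_{k+1}\tau_k=\tau_{k+1}\tau_k\tau_{k+1}$. Its degree-zero part is $\mathbb K S_n$. Put $P_{i,\lambda}=R(ni)\,e_{\lambda}$ for $\lambda\vdash n$ (viewed as the composition of its parts in weakly decreasing order), and regard $S^\mu$ as a graded $R(ni)$-module in degree $0$ on which all $x_k$ act by $0$. Let $\psi$ be the anti-involution of $R(ni)$ that fixes the generators, and let $P^\psi$ be the left module $P$ turned into a right module through $\psi$. Then, for all $\lambda,\mu\vdash n$, the space $P_{i,\lambda}^\psi\otimes_{R(ni)}S^\mu$ is finite-dimensional, and the pairing $$(P_{i,\lambda},S^\mu)=\sum_{d\in\mathbb Z}\dim_{\mathbb K}\bigl(P_{i,\lambda}^\psi\otimes_{R(ni)}S^\mu\bigr)_d\,q^d\in\mathbb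 Z[q,q^{-1}]$$ equals $\dim_{\mathbb K}(e_{\lambda}\cdot S^\mu)$. Consequently the matrix $\bigl((P_{i,\lambda},S^\mu)\bigr)_{\lambda,\mu\vdash n}$ is unitriangular for the lexicographic order: $(P_{i,\lambda},S^\lambda)=1$, and $(P_{i,\lambda},S^\mu)=0$ whenever $\lambda>\mu$. -/

import Mathlib

open scoped TensorProduct LaurentPolynomial

noncomputable section

/-! ### Borcherds-Cartan data -/

/-- A Borcherds-Cartan datum on the index set `I`: an integer matrix `a` with diagonal entries in
`{2, 0, -2, -4, …}` and non-positive off-diagonal entries, symmetrized by positive integers `r i`.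
The symmetric bilinear form on `ℤ[I]` is determined by `i · j = r i * a i j`. -/
structure BorcherdsCartanDatum (I : Type*) [Fintype I] where
  a : Matrix I I ℤ
  r : I → ℤ
  diag : ∀ i, a i i = 2 ∨ (a i i ≤ 0 ∧ Even (a i i))
  offDiag : ∀ i j, i ≠ j → a i j ≤ 0
  r_pos : ∀ i, 0 < r i
  symm : ∀ i j, r i * a i j = r j * a j i

/-! ### Partitions and compositions -/

/-- The parts of a partition in weakly decreasing order. Partitions are compared through these
lists; `<` on `List ℕ` is the lexicographic order. -/
def Nat.Partition.sortedParts {n : ℕ} (p : n.Partition) : List ℕ :=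
  p.parts.sort (· ≥ ·)

/-- A partition, regarded as the composition whose blocks are its parts in weakly decreasing
order. -/
def Nat.Partition.toComposition {n : ℕ} (p : n.Partition) : Composition n where
  blocks := p.sortedParts
  blocks_pos := fun {_} h => p.parts_pos ((Multiset.mem_sort (· ≥ ·)).1 h)
  blocks_sum := by
    rw [← Multiset.sum_coe, Nat.Partition.sortedParts, Multiset.sort_eq, p.parts_sum]

/-! ### The group algebra of the symmetric group -/

/-- The group algebra `K S_n`. -/
abbrev SymGroupAlg (K : Type*) [Field K] (n : ℕ) : Type _ := MonoidAlgebra K (Equiv.Perm (Fin n))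

/-- The idempotent `e_n = (1 / n!) ∑_{ω ∈ S_n} ω`. -/
def trivialIdempotent (K : Type*) [Field K] (n : ℕ) : SymGroupAlg K n :=
  (n.factorial : K)⁻¹ • ∑ ω : Equiv.Perm (Fin n), MonoidAlgebra.of K _ ω

/-- The idempotent `e_c = e_{c₁} ⊗ ⋯ ⊗ e_{c_r}` of `K S_n` attached to a composition
`c = (c₁, …, c_r)` of `n`, where `K S_{c₁} ⊗ ⋯ ⊗ K S_{c_r}` is embedded in `K S_n` by letting the
`j`-th factor permute the `j`-th block of `c` (in Lean, the `j`-th block is the image of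
`c.embedding j`). -/
def compositionIdempotent (K : Type*) [Field K] {n : ℕ} (c : Composition n) : SymGroupAlg K n :=
  (List.ofFn fun j : Fin c.length =>
    MonoidAlgebra.mapDomainRingHom K
      (Equiv.Perm.viaEmbeddingHom (c.embedding j).toEmbedding)
      (trivialIdempotent K (c.blocksFun j))).prod

/-! ### Specht modules -/

open Classical in
/-- The row symmetrizer of the tableau of shape `p` whose rows are filled consecutively: the sum of
all permutations that preserve the rows. The row of the entry `k` is `p.toComposition.index k`. -/
def rowSymmetrizer (K : Type*) [Field K] {n : ℕ} (p : n.Partition) : SymGroupAlg K n :=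
  ∑ σ : Equiv.Perm (Fin n) with
      ∀ k, p.toComposition.index (σ k) = p.toComposition.index k,
    MonoidAlgebra.of K _ σ

open Classical in
/-- The column antisymmetrizer of the same tableau: the signed sum of all permutations that preserve
the columns. The column of the entry `k` is its position `p.toComposition.invEmbedding k` in its
row. -/
def columnAntisymmetrizer (K : Type*) [Field K] {n : ℕ} (p : n.Partition) : SymGroupAlg K n :=
  ∑ σ : Equiv.Perm (Fin n) with
      ∀ k, (p.toComposition.invEmbedding (σ k) : ℕ) = (p.toComposition.invEmbedding k : ℕ),
    ((Equiv.Perm.sign σ : ℤ) : K) • MonoidAlgebra.of K _ σ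

/-- The Specht module `S^p`: the left ideal of `K S_n` generated by the Young symmetrizer, the
product of the row symmetrizer and the column antisymmetrizer. -/
def spechtModule (K : Type*) [Field K] {n : ℕ} (p : n.Partition) : Ideal (SymGroupAlg K n) :=
  Ideal.span {rowSymmetrizer K p * columnAntisymmetrizer K p}

/-- The `K`-subspace `e · V = {e v | v ∈ V}` for a left ideal `V` of `K S_n`. -/
def actionImage (K : Type*) [Field K] {n : ℕ} (e : SymGroupAlg K n) (V : Ideal (SymGroupAlg K n)) :
    Submodule K (SymGroupAlg K n) :=
  (V.restrictScalars K).map (LinearMap.mulLeft K e)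

/-! ### The algebra `R(ni)` for an index `i` with `a i i = 0` -/

/-- The generators of `R(ni)`: the dots `x_1, …, x_n` and the crossings `τ_1, …, τ_{n-1}`
(numbered from `0` here). -/
inductive KLRGen (n : ℕ) : Type
  | x (k : Fin n)
  | tau (k : Fin (n - 1))

/-- The left one of the two strands that meet in the `k`-th crossing. -/
def leftStrand {n : ℕ} (k : Fin (n - 1)) : Fin n := ⟨k, by omega⟩

/-- The right one of the two strands that meet in the `k`-th crossing. -/
def rightStrand {n : ℕ} (k : Fin (n - 1)) : Fin n := ⟨k + 1, by omega⟩

/-- A generator as an element of the free algebra. -/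
abbrev freeX (K : Type*) [Field K] {n : ℕ} (k : Fin n) : FreeAlgebra K (KLRGen n) :=
  FreeAlgebra.ι K (KLRGen.x k)

/-- A generator as an element of the free algebra. -/
abbrev freeTau (K : Type*) [Field K] {n : ℕ} (k : Fin (n - 1)) : FreeAlgebra K (KLRGen n) :=
  FreeAlgebra.ι K (KLRGen.tau k)

/-- The defining relations of `R(ni)` for `a i i = 0`. The relations `x_x`, `tau_x`, `tau_tau` are
the isotopies of diagrams that move distant pieces past each other; the others are the local
relations: a double crossing is trivial, dots slide through crossings, and the braid relation. -/
inductive KLRRel (K : Type*) [Field K] (n : ℕ) :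
    FreeAlgebra K (KLRGen n) → FreeAlgebra K (KLRGen n) → Prop
  | x_x (a b : Fin n) : KLRRel K n (freeX K a * freeX K b) (freeX K b * freeX K a)
  | tau_x (k : Fin (n - 1)) (a : Fin n) (h₁ : a ≠ leftStrand k) (h₂ : a ≠ rightStrand k) :
      KLRRel K n (freeTau K k * freeX K a) (freeX K a * freeTau K k)
  | tau_tau (k l : Fin (n - 1)) (h : (k : ℕ) + 1 < l) :
      KLRRel K n (freeTau K k * freeTau K l) (freeTau K l * freeTau K k)
  | double (k : Fin (n - 1)) : KLRRel K n (freeTau K k * freeTau K k) 1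
  | slide_left (k : Fin (n - 1)) :
      KLRRel K n (freeTau K k * freeX K (leftStrand k)) (freeX K (rightStrand k) * freeTau K k)
  | slide_right (k : Fin (n - 1)) :
      KLRRel K n (freeTau K k * freeX K (rightStrand k)) (freeX K (leftStrand k) * freeTau K k)
  | braid (k l : Fin (n - 1)) (h : (k : ℕ) + 1 = l) :
      KLRRel K n (freeTau K k * freeTau K l * freeTau K k)
        (freeTau K l * freeTau K k * freeTau K l)

/-- The Khovanov-Lauda-Rouquier algebra `R(ni)` for an index `i` with `a i i = 0`. As an ungraded
algebra it depends on `n` only. -/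
abbrev KLRZero (K : Type*) [Field K] (n : ℕ) : Type _ := RingQuot (KLRRel K n)

namespace KLRZero

variable (K : Type*) [Field K] (n : ℕ)

/-- The class of a generator in `R(ni)`. -/
def gen {n : ℕ} (g : KLRGen n) : KLRZero K n :=
  RingQuot.mkAlgHom K (KLRRel K n) (FreeAlgebra.ι K g)

/-- The degrees of the generators: `deg x_k = 2 r_i` and `deg τ_k = - r_i a_{ii}`. -/
def genDegree {I : Type*} [Fintype I] (D : BorcherdsCartanDatum I) (i : I) {n : ℕ} : KLRGen n → ℤ
  | KLRGen.x _ => 2 * D.r i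
  | KLRGen.tau _ => -(D.r i * D.a i i)

/-- The homogeneous component of degree `m` of `R(ni)`: the span of all products of generators of
total degree `m`. -/
def degreePart {I : Type*} [Fintype I] (D : BorcherdsCartanDatum I) (i : I) (m : ℤ) :
    Submodule K (KLRZero K n) :=
  Submodule.span K
    {y | ∃ w : List (KLRGen n), (w.map (genDegree D i)).sum = m ∧ y = (w.map (gen K)).prod}

/-- The anti-involution `ψ` of `R(ni)` that flips diagrams about a horizontal axis: it fixes the
generators and reverses products. -/
def psi : KLRZero K n →ₐ[K] (KLRZero K n)ᵐᵒᵖ :=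
  RingQuot.liftAlgHom K
    ⟨FreeAlgebra.lift K fun g => MulOpposite.op (gen K g), by
      intro u v h
      have key : ∀ {u v : FreeAlgebra K (KLRGen n)}, KLRRel K n u v →
          RingQuot.mkAlgHom K (KLRRel K n) u = RingQuot.mkAlgHom K (KLRRel K n) v :=
        fun h => RingQuot.mkAlgHom_rel K h
      apply MulOpposite.unop_injective
      cases h with
      | x_x a b => simpa [gen] using key (.x_x b a)
      | tau_x k a h₁ h₂ => simpa [gen] using (key (.tau_x k a h₁ h₂)).symm
      | tau_tau k l h => simpa [gen] using (key (.tau_tau k l h)).symm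
      | double k => simpa [gen] using key (.double k)
      | slide_left k => simpa [gen] using (key (.slide_right k)).symm
      | slide_right k => simpa [gen] using (key (.slide_left k)).symm
      | braid k l h => simpa [gen, mul_assoc] using key (.braid k l h)⟩

/-- The adjacent transposition `s_k`. -/
def adjSwap {n : ℕ} (k : Fin (n - 1)) : Equiv.Perm (Fin n) :=
  Equiv.swap (leftStrand k) (rightStrand k)

/-- The quotient map `R(ni) → K S_n` by the ideal that the dots generate: `x_k ↦ 0`,
`τ_k ↦ s_k`. -/
def toSymGroupAlg : KLRZero K n →ₐ[K] SymGroupAlg K n :=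
  RingQuot.liftAlgHom K
    ⟨FreeAlgebra.lift K fun g => match g with
      | KLRGen.x _ => 0
      | KLRGen.tau k => MonoidAlgebra.of K _ (adjSwap k), by
      intro u v h
      cases h with
      | x_x a b => simp
      | tau_x k a h₁ h₂ => simp
      | tau_tau k l h =>
        simp only [map_mul, FreeAlgebra.lift_ι_apply]
        rw [← map_mul, ← map_mul]
        congr 1
        apply Equiv.Perm.Disjoint.commute
        intro t
        by_cases ht : t = leftStrand k ∨ t = rightStrand k
        · right
          apply Equiv.swap_apply_of_ne_of_ne <;>
            rcases ht with rfl | rfl <;> simp [leftStrand, rightStrand, Fin.ext_iff] <;> omega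
        · left
          push Not at ht
          exact Equiv.swap_apply_of_ne_of_ne ht.1 ht.2
      | double k =>
        simp only [map_mul, FreeAlgebra.lift_ι_apply, map_one]
        rw [← map_mul, adjSwap, Equiv.swap_mul_self, map_one]
      | slide_left k => simp
      | slide_right k => simp
      | braid k l h =>
        simp only [map_mul, FreeAlgebra.lift_ι_apply]
        rw [← map_mul, ← map_mul, ← map_mul, ← map_mul]
        congr 1
        have e : leftStrand l = rightStrand k := by
          simp [leftStrand, rightStrand, ← h]
        have h₁ : leftStrand k ≠ rightStrand k := by simp [leftStrand, rightStrand, Fin.ext_iff]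
        have h₂ : rightStrand k ≠ rightStrand l := by
          simp [rightStrand, Fin.ext_iff]; omega
        have h₃ : leftStrand k ≠ rightStrand l := by
          simp [leftStrand, rightStrand, Fin.ext_iff]; omega
        simp only [adjSwap, e]
        rw [Equiv.swap_mul_swap_mul_swap h₁ h₃, Equiv.swap_comm (leftStrand k) (rightStrand k),
          Equiv.swap_comm (rightStrand k) (rightStrand l),
          Equiv.swap_mul_swap_mul_swap h₂.symm h₃.symm, Equiv.swap_comm]⟩

/-- `w` is a reduced expression of `ω`: a shortest word in the adjacent transpositions with
product `ω`. -/
def IsReducedWord {n : ℕ} (ω : Equiv.Perm (Fin n)) (w : List (Fin (n - 1))) : Prop :=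
  (w.map adjSwap).prod = ω ∧
    ∀ w' : List (Fin (n - 1)), (w'.map adjSwap).prod = ω → w.length ≤ w'.length

theorem exists_isReducedWord {n : ℕ} (ω : Equiv.Perm (Fin n)) :
    ∃ w : List (Fin (n - 1)), IsReducedWord ω w := by
  have hne : ∃ w : List (Fin (n - 1)), (w.map adjSwap).prod = ω := by
    rcases n with _ | n
    · exact ⟨[], Subsingleton.elim _ _⟩
    · have hω : ω ∈ Submonoid.closure
          (Set.range fun i : Fin n => Equiv.swap i.castSucc i.succ) := by
        rw [Equiv.Perm.mclosure_swap_castSucc_succ]; trivial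
      induction hω using Submonoid.closure_induction with
      | mem _ h => obtain ⟨k, rfl⟩ := h; exact ⟨[k], by simp [adjSwap]; rfl⟩
      | one => exact ⟨[], rfl⟩
      | mul _ _ _ _ h₁ h₂ =>
        obtain ⟨u, rfl⟩ := h₁
        obtain ⟨v, rfl⟩ := h₂
        exact ⟨u ++ v, by simp⟩
  obtain ⟨w, hw, hmin⟩ := (measure (List.length (α := Fin (n - 1)))).wf.has_min
    {w | (w.map adjSwap).prod = ω} hne
  exact ⟨w, hw, fun w' hw' => not_lt.1 (hmin w' hw')⟩

/-- The element `τ_ω` of `R(ni)`: the product of crossings along a fixed reduced expression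
of `ω`. -/
def tauPerm {n : ℕ} (ω : Equiv.Perm (Fin n)) : KLRZero K n :=
  ((Classical.choose (exists_isReducedWord ω)).map fun k => gen K (KLRGen.tau k)).prod

/-- The embedding of `K S_n` in `R(ni)` as the degree-zero component, `ω ↦ τ_ω`. -/
def ofSymGroupAlg {n : ℕ} (y : SymGroupAlg K n) : KLRZero K n :=
  ∑ ω : Equiv.Perm (Fin n), y.coeff ω • tauPerm K ω

/-- The left module `P_{i,p} = R(ni) · e_{i,p}` for a partition `p` of `n`. -/
def P {n : ℕ} (p : n.Partition) : Ideal (KLRZero K n) :=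
  Ideal.span {ofSymGroupAlg K (compositionIdempotent K p.toComposition)}

/-- The grading of `P_{i,p}` induced by that of `R(ni)`. -/
def gradeP {I : Type*} [Fintype I] (D : BorcherdsCartanDatum I) (i : I) {n : ℕ} (p : n.Partition)
    (m : ℤ) : Submodule K (P K p) :=
  (degreePart K n D i m).comap ((P K p).subtype.restrictScalars K)

/-- The Specht module as an `R(ni)`-module, on which the dots act by zero and `τ_k` acts
as `s_k`. -/
instance spechtModuleKLR {n : ℕ} (p : n.Partition) : Module (KLRZero K n) (spechtModule K p) :=
  Module.compHom _ (toSymGroupAlg K n).toRingHom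

/-- The Specht module is placed in degree zero. -/
def gradeSpecht {n : ℕ} (p : n.Partition) (m : ℤ) : Submodule K (spechtModule K p) :=
  if m = 0 then ⊤ else ⊥

/-- The subspace of `Q ⊗_K M` spanned by the elements `ψ(y) q ⊗ m - q ⊗ y m` with `y ∈ R(ni)`. -/
def balancing (K : Type*) [Field K] (n : ℕ) (Q M : Type*)
    [AddCommGroup Q] [Module K Q] [Module (KLRZero K n) Q]
    [AddCommGroup M] [Module K M] [Module (KLRZero K n) M] : Submodule K (Q ⊗[K] M) :=
  Submodule.span K {t | ∃ (y : KLRZero K n) (q : Q) (m : M),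
    t = ((psi K n y).unop • q) ⊗ₜ[K] m - q ⊗ₜ[K] (y • m)}

/-- The tensor product `Q^ψ ⊗_{R(ni)} M`, where `Q^ψ` is the left module `Q` turned into a right
module by `q · y = ψ(y) q`. -/
abbrev PsiTensor (K : Type*) [Field K] (n : ℕ) (Q M : Type*)
    [AddCommGroup Q] [Module K Q] [Module (KLRZero K n) Q]
    [AddCommGroup M] [Module K M] [Module (KLRZero K n) M] : Type _ :=
  (Q ⊗[K] M) ⧸ balancing K n Q M

/-- The component of degree `d` of `Q^ψ ⊗_{R(ni)} M` for graded modules `Q` and `M`: the sum of the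
images of `Q_a ⊗ M_b` over all `a + b = d`. -/
def gradePsiTensor (K : Type*) [Field K] (n : ℕ) {Q M : Type*}
    [AddCommGroup Q] [Module K Q] [Module (KLRZero K n) Q]
    [AddCommGroup M] [Module K M] [Module (KLRZero K n) M]
    (gQ : ℤ → Submodule K Q) (gM : ℤ → Submodule K M) (d : ℤ) :
    Submodule K (PsiTensor K n Q M) :=
  ⨆ a : ℤ, (Submodule.map₂ (TensorProduct.mk K Q M) (gQ a) (gM (d - a))).map
    (balancing K n Q M).mkQ

/-- The pairing `(Q, M) = Dim (Q^ψ ⊗_{R(ni)} M)`, where `Dim` is the graded dimension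
`∑_d (dim_K of the component of degree d) q^d`, a Laurent polynomial in `q` (written `T`) whenever
`Q^ψ ⊗_{R(ni)} M` has finite dimension. -/
def pairing (K : Type*) [Field K] (n : ℕ) {Q M : Type*}
    [AddCommGroup Q] [Module K Q] [Module (KLRZero K n) Q]
    [AddCommGroup M] [Module K M] [Module (KLRZero K n) M]
    (gQ : ℤ → Submodule K Q) (gM : ℤ → Submodule K M) : ℤ[T;T⁻¹] :=
  ∑ᶠ d : ℤ, LaurentPolynomial.C (Module.finrank K (gradePsiTensor K n gQ gM d) : ℤ) *
    LaurentPolynomial.T d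

/-- The matrix of the pairings `(P_{i,p}, S^p')`, where `p` and `p'` run through the partitions
of `n`. -/
def pairingMatrix {I : Type*} [Fintype I] (D : BorcherdsCartanDatum I) (i : I) :
    Matrix n.Partition n.Partition ℤ[T;T⁻¹] :=
  Matrix.of fun p p' => pairing K n (Q := P K p) (M := spechtModule K p')
    (gradeP K D i p) (gradeSpecht K p')

end KLRZero

end

/-! Write `R_q` for the row symmetrizer and `C_p` for the column antisymmetrizer. The idempotent of
a composition is the average over its Young subgroup, so reordering the blocks conjugates it by a
permutation and does not change the dimension of its image on a left ideal. It is thus enough to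
study `e_q · S^p` for a partition `q`, whose elements are multiples of products `R_q x C_p`.

For a permutation `x = g`, suppose that two entries share a row of `q` and a column of the filling
of `p` translated by `g`. Their transposition is absorbed by `R_q` and turned into a sign by `C_p`,
so the product is its own negative and vanishes. If there is no such pair, the entries can be pushed
up in their columns until each lies no lower than its row in `q` (`exists_perm_row_le`). Counting
the entries of the first `r` rows excludes this when `p < q`. When `p = q` it makes `g` a row
permutation times a column permutation, so `R_p g C_p = ± R_p C_p`. The product `R_p C_p` is nonzero
because its coefficient at the identity is 1.

For the pairing, `q ⊗ m ↦ ψ(q) m` identifies `P^ψ ⊗ S` with `e S`, because the generator of `P` is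
an idempotent fixed by `ψ`. Crossings have degree 0 when `a i i = 0`, so elements of nonzero degree
involve dots, which act by zero; only degree 0 survives. All this needs `ω ↦ τ_ω` to be
multiplicative although `τ_ω` depends on a chosen word, hence the Coxeter presentation of the
symmetric group. -/

noncomputable section

/-! ### The presentation of the symmetric group by adjacent transpositions -/

section Presentation

variable {N : Type*} [Monoid N] (T : ℕ → N)

/-- The product `T j * T (j + 1) * ⋯ * T (j + l - 1)`. -/
def ascendingProd (j : ℕ) : ℕ → N
  | 0 => 1
  | l + 1 => T j * ascendingProd (j + 1) l

/-- The first `b` terms of `T` satisfy the relations of the adjacent transpositions of `S_{b+1}`. -/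
structure IsCoxeterFamily (b : ℕ) : Prop where
  sq : ∀ k < b, T k * T k = 1
  comm : ∀ k l, k + 1 < l → l < b → T k * T l = T l * T k
  braid : ∀ k, k + 1 < b → T k * T (k + 1) * T k = T (k + 1) * T k * T (k + 1)

variable {T} {b : ℕ}

theorem IsCoxeterFamily.mul_ascendingProd_of_lt (h : IsCoxeterFamily T b) (k j l : ℕ)
    (hk : k + 1 < j) (hl : j + l ≤ b) :
    T k * ascendingProd T j l = ascendingProd T j l * T k := by
  induction l generalizing j with
  | zero => simp [ascendingProd]
  | succ l ih =>
    rw [ascendingProd, ← mul_assoc, h.comm k j hk (by omega), mul_assoc,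
      ih (j + 1) (by omega) (by omega), mul_assoc]

/-- `T (k + 1)` commutes with the factors before `T k`; the braid relation at `T k * T (k + 1)`
turns it into `T k`, which commutes with the remaining factors. -/
theorem IsCoxeterFamily.mul_ascendingProd_of_gt (h : IsCoxeterFamily T b) (k j l : ℕ)
    (hj : j ≤ k) (hk : k + 1 < j + l) (hl : j + l ≤ b) :
    T (k + 1) * ascendingProd T j l = ascendingProd T j l * T k := by
  induction l generalizing j with
  | zero => omega
  | succ l ih =>
    rcases hj.eq_or_lt with rfl | hj
    · obtain ⟨l, rfl⟩ : ∃ l', l = l' + 1 := ⟨l - 1, by omega⟩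
      simp only [ascendingProd]
      rw [← mul_assoc, ← mul_assoc, ← h.braid j (by omega), mul_assoc _ (T j),
        h.mul_ascendingProd_of_lt j (j + 1 + 1) l (by omega) (by omega)]
      simp only [mul_assoc]
    · rw [ascendingProd, ← mul_assoc, ← h.comm j (k + 1) (by omega) (by omega), mul_assoc,
        ih (j + 1) (by omega) (by omega) (by omega), mul_assoc]

/-- Coset normal form: the ascending products ending in `T m` stand for the cosets of the subgroup
generated by the earlier generators. Left multiplication by `T k` either passes through to `y`,
lengthens the product (`k + 1 = j`) or shortens it (`k = j`). -/
theorem IsCoxeterFamily.exists_eq_ascendingProd_mul (h : IsCoxeterFamily T b) {m : ℕ} (hm : m < b)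
    {x : N} (hx : x ∈ Submonoid.closure (T '' Set.Iio (m + 1))) :
    ∃ j l y, j + l = m + 1 ∧ y ∈ Submonoid.closure (T '' Set.Iio m) ∧
      x = ascendingProd T j l * y := by
  induction hx using Submonoid.closure_induction_left with
  | one => exact ⟨m + 1, 0, 1, rfl, Submonoid.one_mem _, by simp [ascendingProd]⟩
  | mul_left t ht x hx ih =>
    obtain ⟨k, hk, rfl⟩ := ht
    obtain ⟨j, l, y, hjl, hy, rfl⟩ := ih
    have hk : k < m + 1 := hk
    have mem : ∀ k < m, T k * y ∈ Submonoid.closure (T '' Set.Iio m) := fun k hk =>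
      Submonoid.mul_mem _ (Submonoid.subset_closure ⟨k, hk, rfl⟩) hy
    rcases lt_trichotomy (k + 1) j with hkj | rfl | hkj
    · refine ⟨j, l, _, hjl, mem k (by omega), ?_⟩
      rw [← mul_assoc, h.mul_ascendingProd_of_lt k j l hkj (by omega), mul_assoc]
    · exact ⟨k, l + 1, y, by omega, hy, by rw [ascendingProd, mul_assoc]⟩
    · rcases (Nat.lt_succ_iff.1 hkj).eq_or_lt with rfl | hkj
      · obtain ⟨l, rfl⟩ : ∃ l', l = l' + 1 := ⟨l - 1, by omega⟩
        refine ⟨j + 1, l, y, by omega, hy, ?_⟩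
        rw [ascendingProd, ← mul_assoc, ← mul_assoc, h.sq j (by omega), one_mul]
      · obtain ⟨k, rfl⟩ : ∃ k', k = k' + 1 := ⟨k - 1, by omega⟩
        refine ⟨j, l, _, hjl, mem k (by omega), ?_⟩
        rw [← mul_assoc, h.mul_ascendingProd_of_gt k j l (by omega) (by omega) (by omega),
          mul_assoc]

/-- The image of `m + 1` under `φ x` reads off the coset: `y` fixes `m + 1` and the ascending
product sends it to `j`. So `φ x = 1` forces the empty product, and induction applies to `y`. -/
theorem IsCoxeterFamily.eq_one_of_map_eq_one (h : IsCoxeterFamily T b) (φ : N →* Equiv.Perm ℕ)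
    (hφ : ∀ k < b, φ (T k) = Equiv.swap k (k + 1)) {m : ℕ} (hm : m ≤ b) {x : N}
    (hx : x ∈ Submonoid.closure (T '' Set.Iio m)) (h1 : φ x = 1) : x = 1 := by
  induction m generalizing x with
  | zero => simpa using hx
  | succ m ih =>
    obtain ⟨j, l, y, hjl, hy, rfl⟩ := h.exists_eq_ascendingProd_mul (by omega) hx
    have hy' : φ y (m + 1) = m + 1 := by
      clear h1 hx
      induction hy using Submonoid.closure_induction_left with
      | one => simp
      | mul_left t ht y hy ih =>
        obtain ⟨k, hk, rfl⟩ := ht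
        have hk : k < m := hk
        rw [map_mul, Equiv.Perm.mul_apply, ih, hφ k (by omega)]
        exact Equiv.swap_apply_of_ne_of_ne (by omega) (by omega)
    have hD : ∀ l j, j + l ≤ b → φ (ascendingProd T j l) (j + l) = j := by
      intro l
      induction l with
      | zero => simp [ascendingProd]
      | succ l ih =>
        intro j hj
        have := ih (j + 1) (by omega)
        rw [ascendingProd, map_mul, Equiv.Perm.mul_apply, ← add_assoc, add_right_comm, this,
          hφ j (by omega), Equiv.swap_apply_right]
    have hj : j = m + 1 := by
      rw [← hD l j (by omega), hjl, ← hy', ← Equiv.Perm.mul_apply, ← map_mul, h1, hy']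
      rfl
    obtain rfl : l = 0 := by omega
    rw [ascendingProd, one_mul] at h1 ⊢
    exact ih (by omega) hy h1

end Presentation

namespace KLRZero

variable (K : Type*) [Field K] {n : ℕ}

/-! ### The embedding of the group algebra in degree zero -/

theorem gen_tau_mul_self (k : Fin (n - 1)) :
    gen K (KLRGen.tau k) * gen K (KLRGen.tau k) = 1 := by
  simpa [gen] using RingQuot.mkAlgHom_rel K (KLRRel.double (K := K) k)

theorem gen_tau_mul_comm (k l : Fin (n - 1)) (h : (k : ℕ) + 1 < l) :
    gen K (KLRGen.tau k) * gen K (KLRGen.tau l) = gen K (KLRGen.tau l) * gen K (KLRGen.tau k) := by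
  simpa [gen] using RingQuot.mkAlgHom_rel K (KLRRel.tau_tau (K := K) k l h)

theorem gen_tau_braid (k l : Fin (n - 1)) (h : (k : ℕ) + 1 = l) :
    gen K (KLRGen.tau k) * gen K (KLRGen.tau l) * gen K (KLRGen.tau k) =
      gen K (KLRGen.tau l) * gen K (KLRGen.tau k) * gen K (KLRGen.tau l) := by
  simpa [gen] using RingQuot.mkAlgHom_rel K (KLRRel.braid (K := K) k l h)

/-- The product of the crossings along a word. -/
def tauWord (w : List (Fin (n - 1))) : KLRZero K n :=
  (w.map fun k => gen K (KLRGen.tau k)).prod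

/-- The crossings of `R(ni)` together with the adjacent transpositions of `ℕ`. -/
def crossingPair (n : ℕ) (k : ℕ) : KLRZero K n × Equiv.Perm ℕ :=
  if h : k < n - 1 then (gen K (KLRGen.tau ⟨k, h⟩), Equiv.swap k (k + 1)) else 1

theorem isCoxeterFamily_crossingPair (n : ℕ) : IsCoxeterFamily (crossingPair K n) (n - 1) where
  sq k hk := by
    simp [crossingPair, hk, gen_tau_mul_self]
  comm k l hkl hl := by
    have hk : k < n - 1 := by omega
    simp only [crossingPair, hk, hl, dif_pos, Prod.mk_mul_mk]
    rw [gen_tau_mul_comm K ⟨k, hk⟩ ⟨l, hl⟩ hkl]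
    congr 1
    apply Equiv.Perm.Disjoint.commute
    intro t
    by_cases ht : t = k ∨ t = k + 1
    · right
      exact Equiv.swap_apply_of_ne_of_ne (by omega) (by omega)
    · left
      exact Equiv.swap_apply_of_ne_of_ne (by omega) (by omega)
  braid k hk := by
    have hk' : k < n - 1 := by omega
    simp only [crossingPair, hk, hk', dif_pos, Prod.mk_mul_mk]
    rw [gen_tau_braid K ⟨k, hk'⟩ ⟨k + 1, hk⟩ rfl]
    congr 1
    rw [Equiv.swap_mul_swap_mul_swap (by omega) (by omega), Equiv.swap_comm k (k + 1),
      Equiv.swap_comm (k + 1) (k + 1 + 1),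
      Equiv.swap_mul_swap_mul_swap (by omega) (by omega), Equiv.swap_comm]

theorem _root_.Equiv.Perm.viaEmbeddingHom_swap {α β : Type*} [DecidableEq α] [DecidableEq β]
    (f : α ↪ β) (a b : α) :
    Equiv.Perm.viaEmbeddingHom f (Equiv.swap a b) = Equiv.swap (f a) (f b) := by
  ext x
  rw [Equiv.Perm.viaEmbeddingHom_apply]
  by_cases hx : x ∈ Set.range f
  · obtain ⟨y, rfl⟩ := hx
    rw [Equiv.Perm.viaEmbedding_apply, f.injective.swap_apply]
  · rw [Equiv.Perm.viaEmbedding_apply_of_notMem _ _ _ hx, Equiv.swap_apply_of_ne_of_ne]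
    · rintro rfl; exact hx ⟨a, rfl⟩
    · rintro rfl; exact hx ⟨b, rfl⟩

/-- Working with pairs (crossing, transposition) makes the second projection serve as `φ`, so no
homomorphism from `R(ni)` to permutations is needed. -/
theorem tauWord_eq_one {w : List (Fin (n - 1))} (hw : (w.map adjSwap).prod = 1) :
    tauWord K w = 1 := by
  have key : ∀ w : List (Fin (n - 1)), (w.map fun k : Fin (n - 1) => crossingPair K n k).prod =
      (tauWord K w, Equiv.Perm.viaEmbeddingHom Fin.valEmbedding (w.map adjSwap).prod) := by
    intro w
    induction w with
    | nil => simp [tauWord]; rfl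
    | cons k w ih =>
      rw [List.map_cons, List.prod_cons, ih, crossingPair, dif_pos k.2, Prod.mk_mul_mk]
      simp only [List.map_cons, List.prod_cons, map_mul, adjSwap, tauWord]
      rw [Equiv.Perm.viaEmbeddingHom_swap]
      rfl
  have := (isCoxeterFamily_crossingPair K n).eq_one_of_map_eq_one (MonoidHom.snd _ _)
    (fun k hk => by simp [crossingPair, hk]) le_rfl
    (x := (w.map fun k : Fin (n - 1) => crossingPair K n k).prod)
    (Submonoid.list_prod_mem _ fun x hx => by
      obtain ⟨k, -, rfl⟩ := List.mem_map.1 hx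
      exact Submonoid.subset_closure ⟨k, k.2, rfl⟩)
    (by rw [key, hw]; simp)
  rw [key] at this
  exact congrArg Prod.fst this

theorem tauWord_append (u v : List (Fin (n - 1))) :
    tauWord K (u ++ v) = tauWord K u * tauWord K v := by
  simp [tauWord]

theorem tauWord_mul_reverse (w : List (Fin (n - 1))) : tauWord K w * tauWord K w.reverse = 1 := by
  induction w with
  | nil => simp [tauWord]
  | cons k w ih =>
    rw [List.reverse_cons, tauWord_append, ← mul_assoc, ← List.singleton_append, tauWord_append,
      mul_assoc (tauWord K [k]), ih, mul_one]
    simp [tauWord, gen_tau_mul_self]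

theorem prod_adjSwap_reverse (w : List (Fin (n - 1))) :
    (w.reverse.map adjSwap).prod = ((w.map adjSwap).prod)⁻¹ := by
  rw [List.prod_inv_reverse, List.map_reverse, List.map_map]
  congr 3

theorem tauWord_congr {u v : List (Fin (n - 1))}
    (h : (u.map adjSwap).prod = (v.map adjSwap).prod) : tauWord K u = tauWord K v := by
  have h₁ : tauWord K (u ++ v.reverse) = 1 := tauWord_eq_one K <| by
    rw [List.map_append, List.prod_append, prod_adjSwap_reverse, h, mul_inv_cancel]
  have h₂ := tauWord_mul_reverse K v.reverse
  rw [List.reverse_reverse] at h₂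
  rw [tauWord_append] at h₁
  rw [← mul_one (tauWord K u), ← h₂, ← mul_assoc, h₁, one_mul]

theorem exists_tauPerm_eq (ω : Equiv.Perm (Fin n)) :
    ∃ w : List (Fin (n - 1)), (w.map adjSwap).prod = ω ∧ tauPerm K ω = tauWord K w :=
  ⟨_, (Classical.choose_spec (exists_isReducedWord ω)).1, rfl⟩

/-- The embedding `ω ↦ τ_ω` as a monoid homomorphism. -/
def tauPermHom (n : ℕ) : Equiv.Perm (Fin n) →* KLRZero K n where
  toFun := tauPerm K
  map_one' := by
    obtain ⟨w, hw, h⟩ := exists_tauPerm_eq K (1 : Equiv.Perm (Fin n))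
    rw [h, tauWord_eq_one K hw]
  map_mul' ω ω' := by
    obtain ⟨u, hu, h⟩ := exists_tauPerm_eq K ω
    obtain ⟨v, hv, h'⟩ := exists_tauPerm_eq K ω'
    obtain ⟨w, hw, h''⟩ := exists_tauPerm_eq K (ω * ω')
    rw [h, h', h'', ← tauWord_append]
    exact tauWord_congr K (by simp [hu, hv, hw])

theorem ofSymGroupAlg_eq_lift (y : SymGroupAlg K n) :
    ofSymGroupAlg K y = MonoidAlgebra.lift K _ _ (tauPermHom K n) y := by
  rw [MonoidAlgebra.lift_apply, Finsupp.sum_fintype _ _ (by simp)]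
  rfl

theorem toSymGroupAlg_gen_tau (k : Fin (n - 1)) :
    toSymGroupAlg K n (gen K (KLRGen.tau k)) = MonoidAlgebra.of K _ (adjSwap k) := by
  simp [toSymGroupAlg, gen]

theorem toSymGroupAlg_gen_x (k : Fin n) : toSymGroupAlg K n (gen K (KLRGen.x k)) = 0 := by
  simp [toSymGroupAlg, gen]

theorem toSymGroupAlg_ofSymGroupAlg (y : SymGroupAlg K n) :
    toSymGroupAlg K n (ofSymGroupAlg K y) = y := by
  rw [ofSymGroupAlg_eq_lift]
  have : (toSymGroupAlg K n).comp (MonoidAlgebra.lift K _ _ (tauPermHom K n)) = AlgHom.id K _ := by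
    refine MonoidAlgebra.algHom_ext (fun ω => ?_) (Subsingleton.elim _ _)
    obtain ⟨w, hw, h⟩ := exists_tauPerm_eq K ω
    have : tauPermHom K n ω = tauWord K w := h
    simp only [AlgHom.comp_apply, MonoidAlgebra.lift_single, one_smul, this, AlgHom.id_apply]
    subst hw
    rw [tauWord, map_list_prod, List.map_map, ← MonoidAlgebra.of_apply, map_list_prod, List.map_map]
    congr 2
    ext1 k
    exact toSymGroupAlg_gen_tau K k
  exact congrArg (fun f => f y) this

theorem psi_gen (g : KLRGen n) : psi K n (gen K g) = MulOpposite.op (gen K g) := by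
  simp [psi, gen]

theorem psi_tauPerm (ω : Equiv.Perm (Fin n)) :
    (psi K n (tauPerm K ω)).unop = tauPerm K ω⁻¹ := by
  obtain ⟨w, hw, h⟩ := exists_tauPerm_eq K ω
  obtain ⟨v, hv, h'⟩ := exists_tauPerm_eq K ω⁻¹
  have : (psi K n (tauWord K w)).unop = tauWord K w.reverse := by
    rw [tauWord, map_list_prod, MulOpposite.unop_list_prod, List.map_map, List.map_map,
      tauWord, List.map_reverse]
    congr 3
    ext1 k
    simp [psi_gen]
  rw [h, h', this]
  exact tauWord_congr K (by rw [prod_adjSwap_reverse, hw, hv])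

theorem unop_psi_unop_psi (y : KLRZero K n) :
    (psi K n (psi K n y).unop).unop = y := by
  have : ((AlgEquiv.opOp K (KLRZero K n)).symm : _ →ₐ[K] KLRZero K n).comp
      ((AlgHom.op (psi K n)).comp (psi K n)) = AlgHom.id K _ := by
    apply RingQuot.ringQuot_ext'
    ext g
    change (psi K n (psi K n (gen K g)).unop).unop = gen K g
    simp [psi_gen]
  exact congrArg (fun f => f y) this

end KLRZero

namespace KLRZero

variable (K : Type*) [Field K] {n : ℕ}

/-! ### Pairing a projective module with a Specht module -/

theorem smul_specht_coe {p : n.Partition} (y : KLRZero K n) (m : spechtModule K p) :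
    ((y • m : spechtModule K p) : SymGroupAlg K n) = toSymGroupAlg K n y * m := rfl

instance isScalarTower_spechtModule (p : n.Partition) :
    IsScalarTower K (KLRZero K n) (spechtModule K p) where
  smul_assoc c y m := by
    apply Subtype.ext
    rw [Submodule.coe_smul_of_tower, smul_specht_coe, smul_specht_coe, map_smul, smul_mul_assoc]

/-- Since `a i i = 0`, a word consisting of crossings alone has degree 0. A word of nonzero degree
therefore contains a dot, also after reversal, and dots map to zero. -/
theorem toSymGroupAlg_unop_psi_of_mem_degreePart {I : Type*} [Fintype I]
    (D : BorcherdsCartanDatum I) (i : I) (hi : D.a i i = 0) {m : ℤ} (hm : m ≠ 0) {y : KLRZero K n}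
    (hy : y ∈ degreePart K n D i m) : toSymGroupAlg K n (psi K n y).unop = 0 := by
  induction hy using Submodule.span_induction with
  | zero => simp
  | add a b _ _ ha hb => simp [ha, hb]
  | smul c a _ ha => simp [ha]
  | mem y hy =>
    obtain ⟨w, hw, rfl⟩ := hy
    have hx : ∃ k, KLRGen.x k ∈ w := by
      by_contra! hx
      apply hm
      rw [← hw]
      apply List.sum_eq_zero
      intro d hd
      obtain ⟨g, hg, rfl⟩ := List.mem_map.1 hd
      cases g with
      | x k => exact absurd hg (hx k)
      | tau k => simp [genDegree, hi]
    obtain ⟨k, hk⟩ := hx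
    rw [map_list_prod, MulOpposite.unop_list_prod, map_list_prod]
    apply List.prod_eq_zero
    simp only [List.map_reverse, List.map_map, List.mem_reverse, List.mem_map]
    exact ⟨_, hk, by simp [psi_gen, toSymGroupAlg_gen_x]⟩

theorem ofSymGroupAlg_mem_degreePart {I : Type*} [Fintype I] (D : BorcherdsCartanDatum I) (i : I)
    (hi : D.a i i = 0) (y : SymGroupAlg K n) : ofSymGroupAlg K y ∈ degreePart K n D i 0 := by
  refine Submodule.sum_mem _ fun ω _ => Submodule.smul_mem _ _ (Submodule.subset_span ?_)
  obtain ⟨w, -, h⟩ := exists_tauPerm_eq K ω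
  refine ⟨w.map KLRGen.tau, ?_, ?_⟩
  · apply List.sum_eq_zero
    simp [genDegree, hi]
  · rw [h, tauWord, List.map_map]
    rfl

/-! ### Evaluating the tensor product on an idempotent generator -/

section

variable {Q M : Type*} [AddCommGroup Q] [Module K Q] [Module (KLRZero K n) Q]
  [IsScalarTower K (KLRZero K n) Q]
  [AddCommGroup M] [Module K M] [Module (KLRZero K n) M] [IsScalarTower K (KLRZero K n) M]

variable (n) in
/-- The class of `q ⊗ m` in `Q^ψ ⊗_{R(ni)} M`. -/
def psiTmul (q : Q) (m : M) : PsiTensor K n Q M :=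
  (balancing K n Q M).mkQ (q ⊗ₜ[K] m)

omit [IsScalarTower K (KLRZero K n) Q] [IsScalarTower K (KLRZero K n) M] in
theorem psiTmul_smul (y : KLRZero K n) (q : Q) (m : M) :
    psiTmul K n ((psi K n y).unop • q) m = psiTmul K n q (y • m) :=
  (Submodule.Quotient.eq _).2 (Submodule.subset_span ⟨y, q, m, rfl⟩)

/-- For a submodule `ι : Q → R(ni)`, the map `Q^ψ ⊗_{R(ni)} M → M`, `q ⊗ m ↦ ψ(q) m`. -/
def psiTensorLift (ι : Q →ₗ[KLRZero K n] KLRZero K n) : PsiTensor K n Q M →ₗ[K] M :=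
  (balancing K n Q M).liftQ
    (TensorProduct.lift
      (LinearMap.mk₂ K (fun (q : Q) (m : M) => (psi K n (ι q)).unop • m)
        (fun q q' m => by simp [add_smul])
        (fun c q m => by
          rw [LinearMap.map_smul_of_tower, map_smul, MulOpposite.unop_smul, smul_assoc])
        (fun q m m' => by simp)
        (fun c q m => by
          rw [← algebraMap_smul (KLRZero K n) c m, ← algebraMap_smul (KLRZero K n) c, smul_smul,
            smul_smul, Algebra.commutes])))
    (by
      rw [balancing, Submodule.span_le]
      rintro _ ⟨y, q, m, rfl⟩
      -- The balancing relations die because `ψ(ψ(y) q) = ψ(q) y`.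
      simp [unop_psi_unop_psi, mul_smul])

theorem psiTensorLift_psiTmul (ι : Q →ₗ[KLRZero K n] KLRZero K n) (q : Q) (m : M) :
    psiTensorLift K ι (psiTmul K n q m) = (psi K n (ι q)).unop • m := by
  simp [psiTensorLift, psiTmul]

/-- A generator `g` of a left ideal `ι : Q → R(ni)` that is an idempotent fixed by `ψ`. -/
structure IsPsiIdempotent (ι : Q →ₗ[KLRZero K n] KLRZero K n) (g : Q) : Prop where
  psi_eq : (psi K n (ι g)).unop = ι g
  eq_smul : ∀ q, q = ι q • g

variable {K} {ι : Q →ₗ[KLRZero K n] KLRZero K n} {g : Q}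

omit [IsScalarTower K (KLRZero K n) Q] [IsScalarTower K (KLRZero K n) M] in
theorem IsPsiIdempotent.psiTmul_eq (h : IsPsiIdempotent K ι g) (q : Q) (m : M) :
    psiTmul K n q m = psiTmul K n g ((psi K n (ι q)).unop • m) := by
  rw [← psiTmul_smul, unop_psi_unop_psi, ← h.eq_smul]

omit [IsScalarTower K (KLRZero K n) Q] [IsScalarTower K (KLRZero K n) M] in
theorem IsPsiIdempotent.exists_eq_psiTmul (h : IsPsiIdempotent K ι g) (t : PsiTensor K n Q M) :
    ∃ m, t = psiTmul K n g m := by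
  obtain ⟨t, rfl⟩ := Submodule.mkQ_surjective _ t
  induction t using TensorProduct.induction_on with
  | zero => exact ⟨0, by simp [psiTmul]⟩
  | tmul q m => exact ⟨_, h.psiTmul_eq q m⟩
  | add a b ha hb =>
    obtain ⟨m, hm⟩ := ha
    obtain ⟨m', hm'⟩ := hb
    refine ⟨m + m', ?_⟩
    rw [map_add, hm, hm', psiTmul, psiTmul, psiTmul, TensorProduct.tmul_add, map_add]

/-- Every class has the form `g ⊗ m`, and `g ⊗ m = g ⊗ ψ(g) m`, where `ψ(g) m` is exactly the value
of the map. -/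
theorem IsPsiIdempotent.psiTensorLift_injective (h : IsPsiIdempotent K ι g) :
    Function.Injective (psiTensorLift K (M := M) ι) := by
  rw [injective_iff_map_eq_zero]
  intro t ht
  obtain ⟨m, rfl⟩ := h.exists_eq_psiTmul t
  rw [psiTensorLift_psiTmul] at ht
  rw [h.psiTmul_eq, ht]
  simp [psiTmul]

theorem IsPsiIdempotent.mem_range_psiTensorLift (h : IsPsiIdempotent K ι g) (z : M) :
    z ∈ LinearMap.range (psiTensorLift K (M := M) ι) ↔ ∃ m : M, ι g • m = z := by
  constructor
  · rintro ⟨t, rfl⟩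
    obtain ⟨m, rfl⟩ := h.exists_eq_psiTmul t
    exact ⟨m, by rw [psiTensorLift_psiTmul, h.psi_eq]⟩
  · rintro ⟨m, rfl⟩
    exact ⟨psiTmul K n g m, by rw [psiTensorLift_psiTmul, h.psi_eq]⟩

/-- Only degree zero contributes to the pairing of a left ideal generated in degree zero with a
module in degree zero on which the elements of nonzero degree act trivially. -/
theorem IsPsiIdempotent.pairing_eq (h : IsPsiIdempotent K ι g) (gQ : ℤ → Submodule K Q)
    (gM : ℤ → Submodule K M) (hg : g ∈ gQ 0) (hM : gM 0 = ⊤) (hM' : ∀ d ≠ 0, gM d = ⊥)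
    (hQ : ∀ d ≠ 0, ∀ q ∈ gQ d, ∀ m : M, (psi K n (ι q)).unop • m = 0) :
    pairing K n gQ gM = LaurentPolynomial.C
      (Module.finrank K (LinearMap.range (psiTensorLift K (M := M) ι)) : ℤ) := by
  rw [pairing, finsum_eq_single _ 0]
  · have : gradePsiTensor K n gQ gM 0 = ⊤ := by
      rw [eq_top_iff]
      intro t _
      obtain ⟨m, rfl⟩ := h.exists_eq_psiTmul t
      refine Submodule.mem_iSup_of_mem 0 (Submodule.mem_map_of_mem ?_)
      exact Submodule.apply_mem_map₂ _ hg (by simp [hM])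
    rw [this, finrank_top, LinearMap.finrank_range_of_inj h.psiTensorLift_injective,
      LaurentPolynomial.T_zero, mul_one]
  · intro d hd
    have : gradePsiTensor K n gQ gM d = ⊥ := by
      rw [gradePsiTensor, iSup_eq_bot]
      intro a
      rw [eq_bot_iff, Submodule.map_le_iff_le_comap, Submodule.map₂_le]
      intro q hq m hm
      rw [Submodule.mem_comap, Submodule.mem_bot]
      change psiTmul K n q m = 0
      -- For `a = d` the factor from `Q` has nonzero degree and kills `m`; otherwise `m` lies in a
      -- zero component.
      by_cases ha : d - a = 0
      · obtain rfl : a = d := by omega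
        rw [h.psiTmul_eq, hQ a hd q hq]
        simp [psiTmul]
      · rw [hM' _ ha, Submodule.mem_bot] at hm
        simp [hm, psiTmul]
    rw [this, finrank_bot, Nat.cast_zero, map_zero, zero_mul]

end

/-! ### The pairing of `P_{i,p}` with a Specht module -/

section

variable {p : n.Partition}

/-- The generator of `P_{i,p}` as an element of it. -/
def genP (p : n.Partition) : P K p :=
  ⟨ofSymGroupAlg K (compositionIdempotent K p.toComposition), Submodule.mem_span_singleton_self _⟩

/-- The inclusion of `P_{i,p}` in `R(ni)`. -/
abbrev inclP (p : n.Partition) : P K p →ₗ[KLRZero K n] KLRZero K n := (P K p).subtype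

theorem range_psiTensorLift (h : IsPsiIdempotent K (inclP K p) (genP K p)) (p' : n.Partition) :
    (LinearMap.range (psiTensorLift K (Q := P K p) (M := spechtModule K p') (inclP K p))).map
        ((spechtModule K p').subtype.restrictScalars K) =
      actionImage K (compositionIdempotent K p.toComposition) (spechtModule K p') := by
  have h' : ∀ m : spechtModule K p',
      ((inclP K p (genP K p) • m : spechtModule K p') : SymGroupAlg K n) =
        compositionIdempotent K p.toComposition * m := fun m => by
    rw [smul_specht_coe]
    exact congrArg (· * (m : SymGroupAlg K n)) (toSymGroupAlg_ofSymGroupAlg K _)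
  ext z
  constructor
  · rintro ⟨z, hz, rfl⟩
    obtain ⟨m, rfl⟩ := (h.mem_range_psiTensorLift z).1 hz
    exact ⟨m, m.2, (h' m).symm⟩
  · rintro ⟨m, hm, rfl⟩
    exact ⟨_, (h.mem_range_psiTensorLift _).2 ⟨⟨m, hm⟩, rfl⟩, h' ⟨m, hm⟩⟩

theorem finite_psiTensor (h : IsPsiIdempotent K (inclP K p) (genP K p)) (p' : n.Partition) :
    Module.Finite K (PsiTensor K n (P K p) (spechtModule K p')) := by
  have : Module.Finite K (SymGroupAlg K n) := inferInstance
  exact Module.Finite.of_injective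
    (((spechtModule K p').subtype.restrictScalars K).comp
      (psiTensorLift K (Q := P K p) (M := spechtModule K p') (inclP K p)))
    (Subtype.val_injective.comp h.psiTensorLift_injective)

theorem pairingMatrix_eq {I : Type*} [Fintype I] (D : BorcherdsCartanDatum I) (i : I)
    (hi : D.a i i = 0) (h : IsPsiIdempotent K (inclP K p) (genP K p)) (p' : n.Partition) :
    pairingMatrix K n D i p p' = LaurentPolynomial.C (Module.finrank K
      (actionImage K (compositionIdempotent K p.toComposition) (spechtModule K p')) : ℤ) := by
  have hp := h.pairing_eq (gradeP K D i p) (gradeSpecht K p')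
    (ofSymGroupAlg_mem_degreePart K D i hi _) (if_pos rfl) (fun d hd => if_neg hd)
    (fun d hd q hq m => Subtype.ext <| by
      rw [smul_specht_coe]
      refine (congrArg (· * (m : SymGroupAlg K n))
        (toSymGroupAlg_unop_psi_of_mem_degreePart K D i hi hd hq)).trans (zero_mul _))
  refine hp.trans ?_
  rw [← range_psiTensorLift K h p']
  congr 2
  exact (LinearEquiv.finrank_eq (Submodule.equivMapOfInjective _ Subtype.val_injective _))

end

end KLRZero

/-! ### Rows and columns of the standard filling of a partition -/

/-- A filling of a Young diagram is compared with rows `ρ` of another one: if no column of the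
translate by `g` meets a fibre of `ρ` twice, then its entries can be pushed up in their columns,
to rows that are bounded by `ρ`. -/
theorem exists_perm_row_le {X : Type*} [Fintype X] [DecidableEq X] {row col : X → ℕ}
    (inj : ∀ a b, row a = row b → col a = col b → a = b)
    (down : ∀ k, ∀ i ≤ row k, ∃ m, row m = i ∧ col m = col k)
    {ρ : X → ℕ} {g : Equiv.Perm X}
    (hinj : ∀ a b, ρ a = ρ b → col (g a) = col (g b) → a = b) :
    ∃ θ : Equiv.Perm X, ∀ k, row (θ k) ≤ ρ k ∧ col (θ k) = col (g k) := by
  -- The new row of `k` will be the number of entries in its translated column with smaller `ρ`.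
  -- These entries have distinct `ρ` values below `ρ k`, hence the bound `hFρ`.
  set F : X → Finset X := fun k => {k' | col (g k') = col (g k) ∧ ρ k' < ρ k} with hF
  have hFρ : ∀ k, (F k).card ≤ ρ k := fun k => by
    rw [← Finset.card_range (ρ k)]
    refine Finset.card_le_card_of_injOn ρ (fun a ha => ?_) (fun a ha b hb hab => ?_)
    · simp [hF] at ha
      simp [ha]
    · simp [hF] at ha hb
      exact hinj a b hab (by rw [ha.1, hb.1])
  have hFlt : ∀ k, (F k).card < (Finset.univ.filter fun m => col m = col (g k)).card := fun k => by
    have : (Finset.univ.filter fun m => col m = col (g k)).card =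
        (Finset.univ.filter fun k' => col (g k') = col (g k)).card :=
      Finset.card_equiv g.symm (by simp)
    rw [this]
    apply Finset.card_lt_card
    refine ⟨fun a ha => ?_, fun h => ?_⟩
    · simp [hF] at ha
      simp [ha]
    · have := @h k (by simp)
      simp [hF] at this
  -- By `hFlt` the column has more than `(F k).card` cells, so some cell lies at that row or lower;
  -- `down` then supplies the cell in that row itself.
  have hex : ∀ k, ∃ m, row m = (F k).card ∧ col m = col (g k) := fun k => by
    obtain ⟨m, hm, hr⟩ : ∃ m, col m = col (g k) ∧ (F k).card ≤ row m := by
      by_contra! H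
      refine (hFlt k).not_ge ?_
      conv_rhs => rw [← Finset.card_range (F k).card]
      refine Finset.card_le_card_of_injOn row (fun a ha => ?_) (fun a ha b hb hab => ?_)
      · simpa using H a (by simpa using ha)
      · simp at ha hb
        exact inj a b hab (by rw [ha, hb])
    obtain ⟨m', h₁, h₂⟩ := down m _ hr
    exact ⟨m', h₁, h₂.trans hm⟩
  choose θ hθ₁ hθ₂ using hex
  have hlt : ∀ a b, col (g a) = col (g b) → ρ a < ρ b → (F a).card < (F b).card := by
    intro a b hab h
    apply Finset.card_lt_card
    refine ⟨fun x hx => ?_, fun H => ?_⟩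
    · simp [hF] at hx ⊢
      exact ⟨hx.1.trans hab, hx.2.trans h⟩
    · have := @H a (by simp [hF, hab, h])
      simp [hF] at this
  have hθ : Function.Injective θ := by
    intro a b hab
    have hc : col (g a) = col (g b) := by rw [← hθ₂, ← hθ₂, hab]
    have hf : (F a).card = (F b).card := by rw [← hθ₁, ← hθ₁, hab]
    rcases lt_trichotomy (ρ a) (ρ b) with h | h | h
    · exact absurd hf (hlt a b hc h).ne
    · exact hinj a b h hc
    · exact absurd hf (hlt b a hc.symm h).ne'
  exact ⟨Equiv.ofBijective θ hθ.bijective_of_finite, fun k => ⟨(hθ₁ k).trans_le (hFρ k), hθ₂ k⟩⟩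

namespace Composition

variable {n : ℕ} (c : Composition n)

theorem index_lt_iff (k : Fin n) (r : ℕ) : (c.index k : ℕ) < r ↔ (k : ℕ) < c.sizeUpTo r := by
  constructor
  · intro h
    exact (c.lt_sizeUpTo_index_succ k).trans_le (c.monotone_sizeUpTo h)
  · intro h
    by_contra! H
    exact absurd (h.trans_le (c.monotone_sizeUpTo H)) (c.sizeUpTo_index_le k).not_gt

theorem card_index_lt (r : ℕ) :
    (Finset.univ.filter fun k : Fin n => (c.index k : ℕ) < r).card = c.sizeUpTo r := by
  simp only [index_lt_iff]
  rw [Fin.card_filter_val_lt, min_eq_right (c.sizeUpTo_le r)]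

theorem eq_of_index_eq_of_invEmbedding_eq {a b : Fin n} (h : c.index a = c.index b)
    (h' : (c.invEmbedding a : ℕ) = c.invEmbedding b) : a = b := by
  rw [coe_invEmbedding, coe_invEmbedding, h] at h'
  have h₁ := c.sizeUpTo_index_le a
  have h₂ := c.sizeUpTo_index_le b
  rw [h] at h₁
  omega

/-- Sorting both families of block sizes matches blocks of equal size; the permutation moves each
block onto its partner. -/
theorem exists_equiv_of_blocks_perm {c d : Composition n} (h : c.blocks.Perm d.blocks) :
    ∃ σ : Equiv.Perm (Fin n), ∀ a b,
      d.index (σ a) = d.index (σ b) ↔ c.index a = c.index b := by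
  obtain ⟨e, he⟩ : ∃ e : Fin c.length ≃ Fin d.length, ∀ i, c.blocksFun i = d.blocksFun (e i) := by
    have hl : c.length = d.length := h.length_eq
    set f : Fin c.length → ℕ := fun i => d.blocksFun (Fin.cast hl i) with hf
    have hfd : List.ofFn f = d.blocks := by
      rw [← d.ofFn_blocksFun, List.ofFn_congr hl.symm]
    have hp : (List.ofFn (c.blocksFun ∘ Tuple.sort c.blocksFun)).Perm
        (List.ofFn (f ∘ Tuple.sort f)) := by
      refine (Equiv.Perm.ofFn_comp_perm _ _).trans (List.Perm.trans ?_
        (Equiv.Perm.ofFn_comp_perm _ _).symm)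
      rwa [hfd, c.ofFn_blocksFun]
    have heq := List.ofFn_injective (hp.eq_of_pairwise'
      (List.sortedLE_ofFn_iff.2 (Tuple.monotone_sort _)).pairwise
      (List.sortedLE_ofFn_iff.2 (Tuple.monotone_sort _)).pairwise)
    refine ⟨((Tuple.sort c.blocksFun).symm.trans (Tuple.sort f)).trans (finCongr hl), fun i => ?_⟩
    have := congrFun heq ((Tuple.sort c.blocksFun).symm i)
    simpa [hf] using this
  refine ⟨(c.blocksFinEquiv.symm.trans (Equiv.sigmaCongr e fun i => finCongr (he i))).trans
    d.blocksFinEquiv, fun a b => ?_⟩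
  simp [blocksFinEquiv, Equiv.sigmaCongr]

end Composition

/-- The partial sums separate at the first difference. Positivity covers the case where `l₁` is a
proper prefix of `l₂`. This is how the lexicographic order enters the row counts. -/
theorem List.exists_sum_take_lt_of_lt {l₁ l₂ : List ℕ} (h : l₁ < l₂) (hpos : ∀ a ∈ l₂, 0 < a) :
    ∃ r, (l₁.take r).sum < (l₂.take r).sum := by
  induction (h : List.Lex _ l₁ l₂) with
  | nil => exact ⟨1, by simpa using hpos _ List.mem_cons_self⟩
  | rel h => exact ⟨1, by simpa using h⟩
  | cons _ ih =>
    obtain ⟨r, hr⟩ := ih fun a ha => hpos a (List.mem_cons_of_mem _ ha)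
    exact ⟨r + 1, by simpa using hr⟩

namespace Nat.Partition

variable {n : ℕ}

theorem antitone_blocksFun (p : n.Partition) : Antitone p.toComposition.blocksFun := by
  have h : p.toComposition.blocks.Pairwise (· ≥ ·) := Multiset.pairwise_sort _ _
  exact antitone_iff_forall_lt.2 fun i j hij => List.pairwise_iff_get.1 h i j hij

/-- The row of an entry in the standard filling. -/
def row (p : n.Partition) (k : Fin n) : ℕ := p.toComposition.index k

/-- The column of an entry in the standard filling. -/
def col (p : n.Partition) (k : Fin n) : ℕ := p.toComposition.invEmbedding k

theorem row_eq_iff (p : n.Partition) {a b : Fin n} :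
    p.row a = p.row b ↔ p.toComposition.index a = p.toComposition.index b :=
  Fin.ext_iff.symm

theorem eq_of_row_eq_of_col_eq (p : n.Partition) {a b : Fin n} (h : p.row a = p.row b)
    (h' : p.col a = p.col b) : a = b :=
  p.toComposition.eq_of_index_eq_of_invEmbedding_eq (p.row_eq_iff.1 h) h'

theorem exists_row_eq_of_le (p : n.Partition) (k : Fin n) (i : ℕ) (hi : i ≤ p.row k) :
    ∃ m, p.row m = i ∧ p.col m = p.col k := by
  have hi' : i < p.toComposition.length := hi.trans_lt (p.toComposition.index k).2
  have h : p.toComposition.blocksFun (p.toComposition.index k) ≤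
      p.toComposition.blocksFun ⟨i, hi'⟩ :=
    p.antitone_blocksFun (Fin.le_def.2 hi)
  refine ⟨p.toComposition.embedding ⟨i, hi'⟩
    ⟨p.col k, (p.toComposition.invEmbedding k).2.trans_le h⟩, ?_, ?_⟩
  · rw [row, Composition.index_embedding]
  · rw [col, Composition.invEmbedding_comp]

theorem exists_perm_row_le (p q : n.Partition) {g : Equiv.Perm (Fin n)}
    (h : ∀ a b, q.row a = q.row b → p.col (g a) = p.col (g b) → a = b) :
    ∃ θ : Equiv.Perm (Fin n), ∀ k, p.row (θ k) ≤ q.row k ∧ p.col (θ k) = p.col (g k) :=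
  _root_.exists_perm_row_le (fun _ _ => p.eq_of_row_eq_of_col_eq) p.exists_row_eq_of_le h

/-- If `p < q`, then any translate of the filling of `p` has two entries in a common column that
lie in the same row of `q`. -/
theorem exists_row_eq_col_eq_of_lt {p q : n.Partition} (hpq : p.sortedParts < q.sortedParts)
    (g : Equiv.Perm (Fin n)) :
    ∃ a b, a ≠ b ∧ q.row a = q.row b ∧ p.col (g a) = p.col (g b) := by
  by_contra! H
  obtain ⟨θ, hθ⟩ := p.exists_perm_row_le q (g := g) fun a b h h' => by
    by_contra hab
    exact H a b hab h h'
  obtain ⟨r, hr⟩ := List.exists_sum_take_lt_of_lt hpq fun a ha =>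
    q.parts_pos ((Multiset.mem_sort (· ≥ ·)).1 ha)
  have hr : p.toComposition.sizeUpTo r < q.toComposition.sizeUpTo r := hr
  rw [← Composition.card_index_lt, ← Composition.card_index_lt] at hr
  -- `θ` would inject the first `r` rows of `q` into the first `r` rows of `p`, which have fewer
  -- cells.
  refine hr.not_ge (Finset.card_le_card_of_injOn θ (fun k hk => ?_) θ.injective.injOn)
  simp only [Finset.coe_filter, Finset.mem_univ, true_and, Set.mem_ofPred_eq] at hk ⊢
  exact (hθ k).1.trans_lt hk

/-- If no two entries of a common row of `p` lie in a common column of the translate by `g`, then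
`g` is a product of a row permutation and a column permutation. -/
theorem exists_row_col_perm {p : n.Partition} {g : Equiv.Perm (Fin n)}
    (h : ∀ a b, p.row a = p.row b → p.col (g a) = p.col (g b) → a = b) :
    ∃ θ : Equiv.Perm (Fin n), (∀ k, p.row (θ k) = p.row k) ∧
      ∀ k, p.col (θ k) = p.col (g k) := by
  obtain ⟨θ, hθ⟩ := p.exists_perm_row_le p h
  refine ⟨θ, fun k => ?_, fun k => (hθ k).2⟩
  -- The row numbers have the same total before and after `θ`, so the termwise inequalities are
  -- equalities.
  have := (Finset.sum_eq_sum_iff_of_le (s := Finset.univ) fun k _ => (hθ k).1).1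
    (Equiv.sum_comp θ p.row)
  exact this k (Finset.mem_univ k)

end Nat.Partition

/-! ### Symmetrizers over the fibres of a function -/

section FiberSymmetrizer

variable (K : Type*) [Field K] {n : ℕ} {α : Type*}

/-- The permutations that preserve the fibres of `f`. -/
def fiberPerms (f : Fin n → α) : Subgroup (Equiv.Perm (Fin n)) where
  carrier := {σ | ∀ k, f (σ k) = f k}
  one_mem' _ := rfl
  mul_mem' {σ τ} hσ hτ k := (hσ (τ k)).trans (hτ k)
  inv_mem' {σ} hσ k := by
    have := hσ (σ⁻¹ k)
    rwa [← Equiv.Perm.mul_apply, mul_inv_cancel, Equiv.Perm.one_apply, eq_comm] at this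

theorem mem_fiberPerms {f : Fin n → α} {σ : Equiv.Perm (Fin n)} :
    σ ∈ fiberPerms f ↔ ∀ k, f (σ k) = f k := Iff.rfl

theorem swap_mem_fiberPerms {f : Fin n → α} {a b : Fin n} (h : f a = f b) :
    Equiv.swap a b ∈ fiberPerms f := fun k => by
  rw [Equiv.swap_apply_def]
  split_ifs with h₁ h₂ <;> simp_all

open Classical in
/-- The sum of all permutations that preserve the fibres of `f`. -/
def fiberSum (f : Fin n → α) : SymGroupAlg K n :=
  ∑ σ : Equiv.Perm (Fin n) with ∀ k, f (σ k) = f k, MonoidAlgebra.of K _ σ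

open Classical in
/-- The signed sum of all permutations that preserve the fibres of `f`. -/
def fiberAltSum (f : Fin n → α) : SymGroupAlg K n :=
  ∑ σ : Equiv.Perm (Fin n) with ∀ k, f (σ k) = f k,
    ((Equiv.Perm.sign σ : ℤ) : K) • MonoidAlgebra.of K _ σ

variable {K} {f : Fin n → α} {σ : Equiv.Perm (Fin n)}

theorem of_mul_fiberSum (hσ : σ ∈ fiberPerms f) :
    MonoidAlgebra.of K _ σ * fiberSum K f = fiberSum K f := by
  rw [fiberSum, Finset.mul_sum]
  refine Finset.sum_equiv (Equiv.mulLeft σ) (fun τ => ?_) (fun τ _ => by rw [← map_mul]; rfl)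
  simpa [mem_fiberPerms] using ((fiberPerms f).mul_mem_cancel_left (y := τ) hσ).symm

theorem fiberSum_mul_of (hσ : σ ∈ fiberPerms f) :
    fiberSum K f * MonoidAlgebra.of K _ σ = fiberSum K f := by
  rw [fiberSum, Finset.sum_mul]
  refine Finset.sum_equiv (Equiv.mulRight σ) (fun τ => ?_) (fun τ _ => by rw [← map_mul]; rfl)
  simpa [mem_fiberPerms] using ((fiberPerms f).mul_mem_cancel_right (y := τ) hσ).symm

theorem of_mul_fiberAltSum (hσ : σ ∈ fiberPerms f) :
    MonoidAlgebra.of K _ σ * fiberAltSum K f =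
      ((Equiv.Perm.sign σ : ℤ) : K) • fiberAltSum K f := by
  rw [fiberAltSum, Finset.mul_sum, Finset.smul_sum]
  refine Finset.sum_equiv (Equiv.mulLeft σ) (fun τ => ?_) (fun τ _ => ?_)
  · simpa [mem_fiberPerms] using ((fiberPerms f).mul_mem_cancel_left (y := τ) hσ).symm
  · rw [mul_smul_comm, ← map_mul, smul_smul, ← Int.cast_mul, ← Units.val_mul]
    congr 3
    change _ = _ * Equiv.Perm.sign (σ * τ)
    rw [map_mul, ← mul_assoc, Int.units_mul_self, one_mul]

theorem card_smul_eq_fiberSum_mul {y : SymGroupAlg K n}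
    (hy : ∀ σ ∈ fiberPerms f, MonoidAlgebra.of K _ σ * y = y) :
    fiberSum K f * y = (Nat.card (fiberPerms f) : K) • y := by
  classical
  rw [fiberSum, Finset.sum_mul, Finset.sum_congr rfl (g := fun _ => y) fun σ hσ =>
    hy σ (mem_fiberPerms.2 (Finset.mem_filter.1 hσ).2), Finset.sum_const,
    ← Nat.cast_smul_eq_nsmul K]
  congr 2
  rw [Nat.card_eq_fintype_card, ← Fintype.card_coe]
  exact Fintype.card_congr (Equiv.subtypeEquivRight fun σ => by simp [mem_fiberPerms])

/-- Invariance under the permutations that preserve the fibres of `f` can be checked on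
transpositions. -/
theorem of_mul_eq_of_swap {y : SymGroupAlg K n}
    (hy : ∀ a b, f a = f b → MonoidAlgebra.of K _ (Equiv.swap a b) * y = y)
    (hσ : σ ∈ fiberPerms f) : MonoidAlgebra.of K _ σ * y = y := by
  induction hs : σ.support.card using Nat.strong_induction_on generalizing σ with
  | _ s ih =>
    by_cases h1 : σ = 1
    · rw [h1, map_one, one_mul]
    · obtain ⟨a, ha⟩ : ∃ a, σ a ≠ a := by
        by_contra! H
        exact h1 (Equiv.ext H)
      -- Multiplying by the transposition of `a` and `σ a` makes `a` a fixed point and shrinks the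
      -- support.
      have := ih _ (hs ▸ Equiv.Perm.card_support_swap_mul ha)
        ((fiberPerms f).mul_mem (swap_mem_fiberPerms (hσ a).symm) hσ) rfl
      rw [map_mul, mul_assoc] at this
      calc MonoidAlgebra.of K _ σ * y
          = MonoidAlgebra.of K _ (Equiv.swap a (σ a)) *
              (MonoidAlgebra.of K _ (Equiv.swap a (σ a)) * (MonoidAlgebra.of K _ σ * y)) := by
            rw [← mul_assoc, ← map_mul, Equiv.swap_mul_self, map_one, one_mul]
        _ = y := by rw [this, hy a (σ a) (hσ a).symm]

theorem of_conj_fiberSum {β : Type*} {f' : Fin n → β}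
    (h : ∀ a b, f' (σ a) = f' (σ b) ↔ f a = f b) :
    MonoidAlgebra.of K _ σ * fiberSum K f * MonoidAlgebra.of K _ σ⁻¹ = fiberSum K f' := by
  rw [fiberSum, fiberSum, Finset.mul_sum, Finset.sum_mul]
  refine Finset.sum_equiv (MulAut.conj σ).toEquiv (fun τ => ?_)
    (fun τ _ => by rw [← map_mul, ← map_mul]; rfl)
  simp only [Finset.mem_filter, Finset.mem_univ, true_and]
  constructor
  · intro H k
    obtain ⟨k, rfl⟩ := σ.surjective k
    simpa [h] using H k
  · intro H k
    simpa [h] using H (σ k)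

/-- If `σ * τ = 1`, then `σ = τ⁻¹` preserves the fibres of both functions and is trivial; only the
pair `(1, 1)` contributes. -/
theorem coeff_one_fiberSum_mul_fiberAltSum {β : Type*} {f' : Fin n → β}
    (h : ∀ a b, f a = f b → f' a = f' b → a = b) :
    (fiberSum K f * fiberAltSum K f').coeff 1 = 1 := by
  classical
  have hone : ∀ σ τ : Equiv.Perm (Fin n), (∀ k, f (σ k) = f k) → (∀ k, f' (τ k) = f' k) →
      σ * τ = 1 → σ = 1 := fun σ τ hσ hτ hστ => by
    ext1 k
    refine h _ _ (hσ k) ?_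
    rw [eq_inv_of_mul_eq_one_left hστ]
    exact (fiberPerms f').inv_mem hτ k
  rw [fiberSum, fiberAltSum, Finset.sum_mul_sum, MonoidAlgebra.coeff_sum, Finset.sum_apply']
  rw [Finset.sum_eq_single 1]
  · rw [MonoidAlgebra.coeff_sum, Finset.sum_apply', Finset.sum_eq_single 1]
    · simp
    · intro τ _ hτ
      simp [hτ]
    · simp
  · intro σ hσ hσ1
    rw [MonoidAlgebra.coeff_sum, Finset.sum_apply']
    refine Finset.sum_eq_zero fun τ hτ => ?_
    have : σ * τ ≠ 1 := fun H =>
      hσ1 (hone σ τ (Finset.mem_filter.1 hσ).2 (Finset.mem_filter.1 hτ).2 H)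
    simp [this]
  · simp

end FiberSymmetrizer

/-! ### The idempotent of a composition -/

section CompositionIdempotent

variable (K : Type*) [Field K] {n : ℕ}

theorem List.mul_prod_eq_prod_of_mem {M : Type*} [Monoid M] {x y : M} {l : List M} (hy : y ∈ l)
    (hxy : x * y = y) (h : ∀ z ∈ l, x * z = z ∨ Commute x z) : x * l.prod = l.prod := by
  induction l with
  | nil => simp at hy
  | cons z l ih =>
    rw [List.prod_cons, ← mul_assoc]
    rcases h z List.mem_cons_self with hz | hz
    · rw [hz]
    · rcases List.mem_cons.1 hy with rfl | hy
      · rw [hxy]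
      · rw [hz.eq, mul_assoc, ih hy fun z hz => h z (List.mem_cons_of_mem _ hz)]

/-- The `j`-th factor of the idempotent of a composition. -/
def blockIdempotent (c : Composition n) (j : Fin c.length) : SymGroupAlg K n :=
  MonoidAlgebra.mapDomainRingHom K
    (Equiv.Perm.viaEmbeddingHom (c.embedding j).toEmbedding) (trivialIdempotent K (c.blocksFun j))

theorem compositionIdempotent_eq (c : Composition n) :
    compositionIdempotent K c = (List.ofFn (blockIdempotent K c)).prod := rfl

theorem blockIdempotent_eq (c : Composition n) (j : Fin c.length) :
    blockIdempotent K c j = ((c.blocksFun j).factorial : K)⁻¹ •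
      ∑ ω : Equiv.Perm (Fin (c.blocksFun j)),
        MonoidAlgebra.of K _ (Equiv.Perm.viaEmbeddingHom (c.embedding j).toEmbedding ω) := by
  rw [blockIdempotent, trivialIdempotent, MonoidAlgebra.mapDomainRingHom_apply,
    MonoidAlgebra.mapDomain_smul, ← MonoidAlgebra.mapDomainRingHom_apply, map_sum]
  simp only [MonoidAlgebra.mapDomainRingHom_apply, MonoidAlgebra.of_apply,
    MonoidAlgebra.mapDomain_single]

theorem viaEmbeddingHom_mem_fiberPerms (c : Composition n) (j : Fin c.length)
    (ω : Equiv.Perm (Fin (c.blocksFun j))) :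
    Equiv.Perm.viaEmbeddingHom (c.embedding j).toEmbedding ω ∈ fiberPerms c.index := fun k => by
  rw [Equiv.Perm.viaEmbeddingHom_apply]
  by_cases hk : k ∈ Set.range (c.embedding j).toEmbedding
  · obtain ⟨k, rfl⟩ := hk
    rw [Equiv.Perm.viaEmbedding_apply]
    simp
  · rw [Equiv.Perm.viaEmbedding_apply_of_notMem _ _ _ hk]

theorem of_swap_mul_blockIdempotent (c : Composition n) {a b : Fin n}
    (h : c.index a = c.index b) :
    MonoidAlgebra.of K _ (Equiv.swap a b) * blockIdempotent K c (c.index a) =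
      blockIdempotent K c (c.index a) := by
  obtain ⟨a', ha'⟩ := c.mem_range_embedding a
  obtain ⟨b', hb'⟩ : b ∈ Set.range (c.embedding (c.index a)) := h ▸ c.mem_range_embedding b
  have hswap : Equiv.swap a b = Equiv.Perm.viaEmbeddingHom
      (c.embedding (c.index a)).toEmbedding (Equiv.swap a' b') := by
    rw [Equiv.Perm.viaEmbeddingHom_swap]
    simp only [RelEmbedding.coe_toEmbedding, ha', hb']
  rw [blockIdempotent_eq, mul_smul_comm, hswap, Finset.mul_sum]
  simp only [← map_mul]
  congr 1
  exact Equiv.sum_comp (Equiv.mulLeft (Equiv.swap a' b')) fun ω => MonoidAlgebra.of K _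
    (Equiv.Perm.viaEmbeddingHom (c.embedding (c.index a)).toEmbedding ω)

/-- The transposition commutes with the factors of the other blocks, by disjointness, and is
absorbed by the factor of its own block. -/
theorem of_swap_mul_compositionIdempotent (c : Composition n) {a b : Fin n}
    (h : c.index a = c.index b) :
    MonoidAlgebra.of K _ (Equiv.swap a b) * compositionIdempotent K c =
      compositionIdempotent K c := by
  rw [compositionIdempotent_eq]
  refine List.mul_prod_eq_prod_of_mem
    (List.mem_ofFn.2 ⟨c.index a, rfl⟩) (of_swap_mul_blockIdempotent K c h) fun z hz => ?_
  obtain ⟨j, rfl⟩ := List.mem_ofFn.1 hz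
  by_cases hj : j = c.index a
  · left
    rw [hj, of_swap_mul_blockIdempotent K c h]
  · right
    rw [blockIdempotent_eq]
    refine Commute.smul_right (Commute.sum_right _ _ _ fun ω _ => ?_) _
    refine Commute.map (Equiv.Perm.Disjoint.commute fun k => ?_) (MonoidAlgebra.of K _)
    by_cases hk : k ∈ Set.range (c.embedding j)
    · left
      have hk := c.mem_range_embedding_iff'.1 hk
      exact Equiv.swap_apply_of_ne_of_ne (by rintro rfl; exact hj hk)
        (by rintro rfl; exact hj (hk.trans h.symm))
    · right
      exact Equiv.Perm.viaEmbedding_apply_of_notMem _ _ _ hk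

variable [CharZero K]

theorem fiberSum_mul_compositionIdempotent (c : Composition n) :
    fiberSum K c.index * compositionIdempotent K c = fiberSum K c.index := by
  rw [compositionIdempotent_eq]
  have h : ∀ z ∈ List.ofFn (blockIdempotent K c), fiberSum K c.index * z = fiberSum K c.index := by
    intro z hz
    obtain ⟨j, rfl⟩ := List.mem_ofFn.1 hz
    rw [blockIdempotent_eq, mul_smul_comm, Finset.mul_sum, Finset.sum_congr rfl fun ω _ =>
      fiberSum_mul_of (viaEmbeddingHom_mem_fiberPerms c j ω), Finset.sum_const, Finset.card_univ,
      Fintype.card_perm, Fintype.card_fin, ← Nat.cast_smul_eq_nsmul K, smul_smul,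
      inv_mul_cancel₀ (Nat.cast_ne_zero.2 (Nat.factorial_ne_zero _)), one_smul]
  generalize List.ofFn (blockIdempotent K c) = l at h
  induction l with
  | nil => simp
  | cons z l ih =>
    rw [List.prod_cons, ← mul_assoc, h z List.mem_cons_self,
      ih fun z hz => h z (List.mem_cons_of_mem _ hz)]

/-- The idempotent of a composition is the average of the permutations that preserve its blocks. -/
theorem compositionIdempotent_eq_smul_fiberSum (c : Composition n) :
    compositionIdempotent K c = (Nat.card (fiberPerms c.index) : K)⁻¹ • fiberSum K c.index := by
  -- The product of the fibre sum and the idempotent is evaluated in two ways: the idempotent is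
  -- absorbed on the right, and the sum acts as the group order on the left. No product
  -- decomposition of the Young subgroup is needed.
  rw [← fiberSum_mul_compositionIdempotent, card_smul_eq_fiberSum_mul fun σ hσ =>
    of_mul_eq_of_swap (fun a b h => of_swap_mul_compositionIdempotent K c h) hσ, smul_smul,
    inv_mul_cancel₀ (Nat.cast_ne_zero.2 Nat.card_pos.ne'), one_smul]

theorem compositionIdempotent_mul_of_invariant (c : Composition n) {y : SymGroupAlg K n}
    (hy : ∀ σ ∈ fiberPerms c.index, MonoidAlgebra.of K _ σ * y = y) :
    compositionIdempotent K c * y = y := by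
  rw [compositionIdempotent_eq_smul_fiberSum, smul_mul_assoc, card_smul_eq_fiberSum_mul hy,
    smul_smul, inv_mul_cancel₀ (Nat.cast_ne_zero.2 Nat.card_pos.ne'), one_smul]

theorem compositionIdempotent_mul_self (c : Composition n) :
    compositionIdempotent K c * compositionIdempotent K c = compositionIdempotent K c :=
  compositionIdempotent_mul_of_invariant K c fun _ hσ =>
    of_mul_eq_of_swap (fun _ _ h => of_swap_mul_compositionIdempotent K c h) hσ

end CompositionIdempotent

/-! ### The action of the idempotents on Specht modules -/

section Specht

variable (K : Type*) [Field K] {n : ℕ}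

theorem rowSymmetrizer_eq (p : n.Partition) :
    rowSymmetrizer K p = fiberSum K p.toComposition.index := by
  unfold rowSymmetrizer fiberSum
  congr!

theorem columnAntisymmetrizer_eq (p : n.Partition) :
    columnAntisymmetrizer K p = fiberAltSum K p.col := by
  unfold columnAntisymmetrizer fiberAltSum
  congr!

theorem rowSymmetrizer_mul_columnAntisymmetrizer_ne_zero (p : n.Partition) :
    rowSymmetrizer K p * columnAntisymmetrizer K p ≠ 0 := fun h => by
  have := coeff_one_fiberSum_mul_fiberAltSum (K := K) (f := p.toComposition.index) (f' := p.col)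
    fun a b ha hb => p.eq_of_row_eq_of_col_eq (p.row_eq_iff.2 ha) hb
  rw [← rowSymmetrizer_eq, ← columnAntisymmetrizer_eq, h] at this
  simp at this

/-- An identity that is linear in an element of the group algebra can be checked on group
elements. -/
theorem mul_mul_mem_of_forall_of {a b : SymGroupAlg K n} {W : Submodule K (SymGroupAlg K n)}
    (h : ∀ g, a * MonoidAlgebra.of K _ g * b ∈ W) (x : SymGroupAlg K n) : a * x * b ∈ W := by
  induction x using MonoidAlgebra.induction_on with
  | of g => exact h g
  | add x y hx hy => rw [mul_add, add_mul]; exact W.add_mem hx hy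
  | smul c x hx => rw [mul_smul_comm, smul_mul_assoc]; exact W.smul_mem c hx

/-- The images `e_c · V` for two compositions that differ by the order of their blocks are
translates of each other. -/
theorem finrank_actionImage_of_perm [CharZero K] {c d : Composition n}
    (h : c.blocks.Perm d.blocks) (V : Ideal (SymGroupAlg K n)) :
    Module.finrank K (actionImage K (compositionIdempotent K c) V) =
      Module.finrank K (actionImage K (compositionIdempotent K d) V) := by
  obtain ⟨σ, hσ⟩ := Composition.exists_equiv_of_blocks_perm h
  set s := MonoidAlgebra.of K (Equiv.Perm (Fin n)) σ with hs
  set t := MonoidAlgebra.of K (Equiv.Perm (Fin n)) σ⁻¹ with ht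
  have hts : t * s = 1 := by rw [hs, ht, ← map_mul, inv_mul_cancel, map_one]
  have hst : s * t = 1 := by rw [hs, ht, ← map_mul, mul_inv_cancel, map_one]
  have hsum : s * fiberSum K c.index * t = fiberSum K d.index := of_conj_fiberSum hσ
  have hcard : Nat.card (fiberPerms c.index) = Nat.card (fiberPerms d.index) := by
    refine Nat.card_congr ((MulAut.conj σ).toEquiv.subtypeEquiv fun τ => ?_)
    simp only [mem_fiberPerms]
    constructor
    · intro H k
      obtain ⟨k, rfl⟩ := σ.surjective k
      simpa [hσ] using H k
    · intro H k
      simpa [hσ] using H (σ k)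
  have hidem : s * compositionIdempotent K c * t = compositionIdempotent K d := by
    rw [compositionIdempotent_eq_smul_fiberSum, compositionIdempotent_eq_smul_fiberSum,
      mul_smul_comm, smul_mul_assoc, hsum, hcard]
  have himage : actionImage K (compositionIdempotent K d) V =
      (actionImage K (compositionIdempotent K c) V).map (LinearMap.mulLeft K s) := by
    ext z
    constructor
    · rintro ⟨v, hv, rfl⟩
      refine ⟨_, ⟨t * v, V.mul_mem_left t hv, rfl⟩, ?_⟩
      simp only [LinearMap.mulLeft_apply, ← hidem, mul_assoc]
    · rintro ⟨_, ⟨v, hv, rfl⟩, rfl⟩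
      refine ⟨s * v, V.mul_mem_left s hv, ?_⟩
      simp only [LinearMap.mulLeft_apply, ← hidem, mul_assoc]
      rw [← mul_assoc t, hts, one_mul]
  have hinj : Function.Injective (LinearMap.mulLeft K s) := fun x y hxy => by
    have := congrArg (t * ·) hxy
    simpa only [LinearMap.mulLeft_apply, ← mul_assoc, hts, one_mul] using this
  rw [himage]
  exact (Submodule.equivMapOfInjective _ hinj _).finrank_eq

variable [CharZero K]

/-- The transposition of `a` and `b` is absorbed by the row symmetrizer. Moved across `g`, it
becomes that of `g⁻¹ a` and `g⁻¹ b`, on which the antisymmetrizer gives -1. Hence twice the product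
is zero. -/
theorem rowSymmetrizer_mul_of_mul_columnAntisymmetrizer_eq_zero {p q : n.Partition}
    {g : Equiv.Perm (Fin n)} {a b : Fin n} (hab : a ≠ b) (hq : q.row a = q.row b)
    (hp : p.col (g⁻¹ a) = p.col (g⁻¹ b)) :
    rowSymmetrizer K q * MonoidAlgebra.of K _ g * columnAntisymmetrizer K p = 0 := by
  have h₁ := fiberSum_mul_of (K := K) (swap_mem_fiberPerms (q.row_eq_iff.1 hq))
  have h₂ := of_mul_fiberAltSum (K := K) (swap_mem_fiberPerms hp)
  rw [← rowSymmetrizer_eq] at h₁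
  rw [← columnAntisymmetrizer_eq, Equiv.Perm.sign_swap (by simpa using hab)] at h₂
  have h₃ : Equiv.swap a b * g = g * Equiv.swap (g⁻¹ a) (g⁻¹ b) := by
    rw [Equiv.mul_swap_eq_swap_mul]
    simp
  have h₄ : rowSymmetrizer K q * MonoidAlgebra.of K _ g * columnAntisymmetrizer K p =
      -(rowSymmetrizer K q * MonoidAlgebra.of K _ g * columnAntisymmetrizer K p) := by
    conv_lhs => rw [← h₁, mul_assoc (rowSymmetrizer K q), ← map_mul, h₃, map_mul, ← mul_assoc,
      mul_assoc, h₂]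
    simp
  have h₅ : (2 : K) • (rowSymmetrizer K q * MonoidAlgebra.of K _ g *
      columnAntisymmetrizer K p) = 0 := by
    rw [two_smul]
    exact add_eq_zero_iff_eq_neg.2 h₄
  exact (smul_eq_zero.1 h₅).resolve_left two_ne_zero

theorem rowSymmetrizer_mul_mul_columnAntisymmetrizer_of_lt {p q : n.Partition}
    (hpq : p.sortedParts < q.sortedParts) (x : SymGroupAlg K n) :
    rowSymmetrizer K q * x * columnAntisymmetrizer K p = 0 := by
  rw [← Submodule.mem_bot K]
  refine mul_mul_mem_of_forall_of K (fun g => ?_) x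
  obtain ⟨a, b, hab, hq, hp⟩ := Nat.Partition.exists_row_eq_col_eq_of_lt hpq g⁻¹
  rw [Submodule.mem_bot, rowSymmetrizer_mul_of_mul_columnAntisymmetrizer_eq_zero K hab hq hp]

theorem rowSymmetrizer_mul_mul_columnAntisymmetrizer_mem (p : n.Partition) (x : SymGroupAlg K n) :
    rowSymmetrizer K p * x * columnAntisymmetrizer K p ∈
      Submodule.span K {rowSymmetrizer K p * columnAntisymmetrizer K p} := by
  refine mul_mul_mem_of_forall_of K (fun g => ?_) x
  -- Without a repeated row-column pair, `g = θ⁻¹ * (θ * g)` with `θ` preserving rows and `θ * g`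
  -- preserving columns; otherwise the product vanishes.
  by_cases h : ∀ a b, p.row a = p.row b → p.col (g⁻¹ a) = p.col (g⁻¹ b) → a = b
  · obtain ⟨θ, hθ, hθ'⟩ := Nat.Partition.exists_row_col_perm h
    have h₁ : θ ∈ fiberPerms p.toComposition.index := fun k => p.row_eq_iff.1 (hθ k)
    have h₂ : θ * g ∈ fiberPerms p.col := fun k => by
      rw [Equiv.Perm.mul_apply, hθ', ← Equiv.Perm.mul_apply, inv_mul_cancel, Equiv.Perm.one_apply]
    have h₃ := fiberSum_mul_of (K := K) h₁
    have h₄ := of_mul_fiberAltSum (K := K) h₂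
    rw [← rowSymmetrizer_eq] at h₃
    rw [← columnAntisymmetrizer_eq] at h₄
    have h₅ : rowSymmetrizer K p * MonoidAlgebra.of K _ g * columnAntisymmetrizer K p =
        ((Equiv.Perm.sign (θ * g) : ℤ) : K) •
          (rowSymmetrizer K p * columnAntisymmetrizer K p) := by
      conv_lhs => rw [← h₃, mul_assoc (rowSymmetrizer K p), ← map_mul, mul_assoc, h₄,
        mul_smul_comm]
    rw [h₅]
    exact Submodule.smul_mem _ _ (Submodule.mem_span_singleton_self _)
  · push Not at h
    obtain ⟨a, b, hq, hp, hab⟩ := h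
    rw [rowSymmetrizer_mul_of_mul_columnAntisymmetrizer_eq_zero K hab hq hp]
    exact Submodule.zero_mem _

theorem compositionIdempotent_toComposition (q : n.Partition) :
    compositionIdempotent K q.toComposition =
      (Nat.card (fiberPerms q.toComposition.index) : K)⁻¹ • rowSymmetrizer K q := by
  rw [compositionIdempotent_eq_smul_fiberSum, rowSymmetrizer_eq]

theorem actionImage_of_lt {p q : n.Partition} (hpq : p.sortedParts < q.sortedParts) :
    actionImage K (compositionIdempotent K q.toComposition) (spechtModule K p) = ⊥ := by
  rw [eq_bot_iff]
  rintro _ ⟨v, hv, rfl⟩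
  obtain ⟨y, rfl⟩ := Submodule.mem_span_singleton.1 hv
  rw [LinearMap.mulLeft_apply, compositionIdempotent_toComposition, smul_mul_assoc, smul_eq_mul,
    ← mul_assoc, ← mul_assoc, mul_assoc (rowSymmetrizer K q),
    rowSymmetrizer_mul_mul_columnAntisymmetrizer_of_lt K hpq, smul_zero]
  exact Submodule.zero_mem _

theorem actionImage_self (p : n.Partition) :
    actionImage K (compositionIdempotent K p.toComposition) (spechtModule K p) =
      Submodule.span K {rowSymmetrizer K p * columnAntisymmetrizer K p} := by
  apply le_antisymm
  · rintro _ ⟨v, hv, rfl⟩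
    obtain ⟨y, rfl⟩ := Submodule.mem_span_singleton.1 hv
    rw [LinearMap.mulLeft_apply, compositionIdempotent_toComposition, smul_mul_assoc, smul_eq_mul,
      ← mul_assoc, ← mul_assoc, mul_assoc (rowSymmetrizer K p)]
    exact Submodule.smul_mem _ _ (rowSymmetrizer_mul_mul_columnAntisymmetrizer_mem K p _)
  · rw [Submodule.span_singleton_le_iff_mem]
    refine ⟨_, Submodule.mem_span_singleton_self _, ?_⟩
    rw [LinearMap.mulLeft_apply]
    -- The Young symmetrizer is its own preimage: its left factor is invariant under row
    -- permutations.
    refine compositionIdempotent_mul_of_invariant K _ fun σ hσ => ?_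
    rw [rowSymmetrizer_eq, ← mul_assoc, of_mul_fiberSum hσ]

theorem finrank_actionImage_self (p : n.Partition) :
    Module.finrank K
      (actionImage K (compositionIdempotent K p.toComposition) (spechtModule K p)) = 1 := by
  rw [actionImage_self]
  exact finrank_span_singleton (rowSymmetrizer_mul_columnAntisymmetrizer_ne_zero K p)

theorem finrank_actionImage_of_lt {p q : n.Partition} (hpq : p.sortedParts < q.sortedParts) :
    Module.finrank K
      (actionImage K (compositionIdempotent K q.toComposition) (spechtModule K p)) = 0 := by
  rw [actionImage_of_lt K hpq, finrank_bot]

theorem blocks_perm_toComposition_ofComposition (c : Composition n) :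
    c.blocks.Perm (Nat.Partition.ofComposition n c).toComposition.blocks := by
  rw [← Multiset.coe_eq_coe]
  exact (Multiset.sort_eq _ _).symm

/-! ### The generator of `P_{i,p}` is an idempotent fixed by `ψ` -/

namespace KLRZero

-- `ψ` sends `τ_σ` to `τ_{σ⁻¹}`, and the summation set is a subgroup.
omit [CharZero K] in
theorem unop_psi_ofSymGroupAlg_fiberSum {α : Type*} (f : Fin n → α) :
    (psi K n (ofSymGroupAlg K (fiberSum K f))).unop = ofSymGroupAlg K (fiberSum K f) := by
  classical
  have h : ofSymGroupAlg K (fiberSum K f) =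
      ∑ σ : Equiv.Perm (Fin n) with ∀ k, f (σ k) = f k, tauPerm K σ := by
    rw [ofSymGroupAlg_eq_lift, fiberSum, map_sum]
    simp only [MonoidAlgebra.lift_of]
    congr!
  rw [h, map_sum, Finset.unop_sum]
  simp only [psi_tauPerm]
  refine Finset.sum_equiv (Equiv.inv _) (fun σ => ?_) fun σ _ => rfl
  simp only [Finset.mem_filter, Finset.mem_univ, true_and]
  exact ((fiberPerms f).inv_mem_iff (x := σ)).symm

theorem isPsiIdempotent_genP (p : n.Partition) : IsPsiIdempotent K (inclP K p) (genP K p) where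
  psi_eq := by
    change (psi K n (ofSymGroupAlg K (compositionIdempotent K p.toComposition))).unop =
      ofSymGroupAlg K (compositionIdempotent K p.toComposition)
    have h := unop_psi_ofSymGroupAlg_fiberSum K p.toComposition.index
    rw [ofSymGroupAlg_eq_lift] at h ⊢
    rw [compositionIdempotent_eq_smul_fiberSum, map_smul, map_smul, MulOpposite.unop_smul, h]
  eq_smul q := by
    obtain ⟨q, hq⟩ := q
    obtain ⟨r, rfl⟩ := Submodule.mem_span_singleton.1 hq
    apply Subtype.ext
    change r * ofSymGroupAlg K (compositionIdempotent K p.toComposition) =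
      r * ofSymGroupAlg K (compositionIdempotent K p.toComposition) *
        ofSymGroupAlg K (compositionIdempotent K p.toComposition)
    rw [mul_assoc, ofSymGroupAlg_eq_lift, ← map_mul, compositionIdempotent_mul_self]

end KLRZero

end Specht

theorem mainTheorem9 (K : Type*) [Field K] [IsAlgClosed K] [CharZero K] (n : ℕ) :
    (∀ (p : n.Partition) (c : Composition n),
      (Nat.Partition.ofComposition n c = p →
        Module.finrank K (actionImage K (compositionIdempotent K c) (spechtModule K p)) = 1) ∧
      (p.sortedParts < (Nat.Partition.ofComposition n c).sortedParts →
        Module.finrank K (actionImage K (compositionIdempotent K c) (spechtModule K p)) = 0)) ∧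
    (∀ {I : Type*} [Fintype I] (D : BorcherdsCartanDatum I) (i : I), D.a i i = 0 →
      (∀ p p' : n.Partition,
        Module.Finite K (KLRZero.PsiTensor K n (KLRZero.P K p) (spechtModule K p')) ∧
        KLRZero.pairingMatrix K n D i p p' =
          LaurentPolynomial.C (Module.finrank K
            (actionImage K (compositionIdempotent K p.toComposition) (spechtModule K p')) : ℤ)) ∧
      (∀ p : n.Partition, KLRZero.pairingMatrix K n D i p p = 1) ∧
      (∀ p p' : n.Partition, p'.sortedParts < p.sortedParts →
        KLRZero.pairingMatrix K n D i p p' = 0)) := by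
  refine ⟨fun p c => ⟨?_, fun h => ?_⟩, fun D i hi => ?_⟩
  · rintro rfl
    rw [finrank_actionImage_of_perm K (blocks_perm_toComposition_ofComposition c),
      finrank_actionImage_self]
  · rw [finrank_actionImage_of_perm K (blocks_perm_toComposition_ofComposition c),
      finrank_actionImage_of_lt K h]
  · have key := fun p p' : n.Partition =>
      KLRZero.pairingMatrix_eq K D i hi (KLRZero.isPsiIdempotent_genP K p) p'
    refine ⟨fun p p' => ⟨KLRZero.finite_psiTensor K (KLRZero.isPsiIdempotent_genP K p) p',
      key p p'⟩, fun p => ?_, fun p p' h => ?_⟩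
    · rw [key, finrank_actionImage_self, Nat.cast_one, map_one]
    · rw [key, finrank_actionImage_of_lt K h, Nat.cast_zero, map_zero]

end
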